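/- Let $M$ be a smooth $7$-manifold. A $\mathrm G_2$ form is a smooth $3$-form $\varphi$ on $M$ which at each point can be written as $e^{127}+e^{347}+e^{567}+e^{135}-e^{146}-e^{236}-e^{245}$ in some coframe; it determines a metric $g_\varphi$ and an orientation, with volume form $vol_\varphi$, by $g_\varphi(X,Y)\,vol_\varphi=\frac16\,\iota_X\varphi\wedge\iota_Y\varphi\wedge\varphi$, a Hodge star $\star_\varphi$, and the dual form $\psi=\star_\varphi\varphi$; it is coclosed if $d\psi=0$. Its torsion forms are the smooth forms $\tau_0\in\Omega^0$, $\tau_1\in\Omega^1$, $\tau_2\in\Omega^2$ with $\tau_2\wedge\varphi=-\star_\varphi\tau_2$, and $\tau_3\in\Omega^3$ with $\tau_3\wedge\varphi=0=\tau_3\wedge\psi$, such that $$d\varphi=\tau_0\psi+3\tau_1\wedge\varphi+\star_\varphi\tau_3,\qquad d\psi=4\tau_1\wedge\psi-\star_\varphi\tau_2 .$$ Its full torsion tensor is $\tau=\frac14\tau_0 g_\varphi-\iota_{U}\varphi-\frac13 j_\varphi(\tau_3)+\frac12\tau_2$, where $g_\varphi(U,\cdot)=\tau_1$ and $j_\varphi(\gamma)(X,Y)=\star_\varphi(\iota_X\varphi\wedge\iota_Y\varphi\wedge\gamma)$.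 Let $\varphi_0$ be a coclosed $\mathrm G_2$ form on $M$ with $\psi_0=\star_{\varphi_0}\varphi_0$, let $A>0$ be a constant, let $I\subseteq\mathbb R$ be a nondegenerate interval containing $0$, and let $\varphi(t)$, $t\in I$, be $\mathrm G_2$ forms on $M$ such that $\varphi(0)$ and $\varphi_0$ induce the same orientation. Let $\psi(t)=\star_t\varphi(t)$, let $\tau_0(t),\dots,\tau_3(t)$ be the torsion forms of $\varphi(t)$ and $\tau(t)$ its full torsion tensor, and let $\star_t$, $\Delta_t=dd^*+d^*d$ and $\mathrm{Tr}_t$ be the Hodge star, Hodge Laplacian and trace of $g_{\varphi(t)}$ (with the orientation induced by $\varphi(t)$). Then the following hold. (1) For every $t\in I$ with $d\psi(t)=0$, $$\mathrm{Tr}_t\,\tau(t)=\tfrac74\tau_0(t),$$ $$-\Delta_t\psi(t)=-d\tau_0(t)\wedge\varphi(t)-\tau_0(t)^2\psi(t)-\tau_0(t)\star_t\tau_3(t)-d\tau_3(t),$$ $$\Delta_t\psi(t)+2d\big((A-\mathrm{Tr}_t\tau(t))\varphi(t)\big)=\tau_0(t)\big(2A-\tfrac52\tau_0(t)\big)\psi(t)+\big(2A-\tfrac52\tau_0(t)\big)\star_t\tau_3(t)+d\tau_3(t)+\tfrac52\varphi(t)\wedge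 d\tau_0(t).$$ (2) $\varphi(t)$ solves the Laplacian coflow $\partial_t\psi(t)=-\Delta_t\psi(t)$, $d\psi(t)=0$, $\psi(0)=\psi_0$ on $I$ if and only if on $I$ $$(\mathrm C)\quad \partial_t\psi(t)=-d\tau_0(t)\wedge\varphi(t)-\tau_0(t)^2\psi(t)-\tau_0(t)\star_t\tau_3(t)-d\tau_3(t),\quad d\psi(t)=0,\quad \varphi(0)=\varphi_0 .$$ (3) $\varphi(t)$ solves the modified Laplacian coflow $\partial_t\psi(t)=\Delta_t\psi(t)+2d\big((A-\mathrm{Tr}_t\tau(t))\varphi(t)\big)$, $d\psi(t)=0$, $\psi(0)=\psi_0$ on $I$ if and only if on $I$ $$(\mathrm G)\quad \partial_t\psi(t)=\tau_0(t)\big(2A-\tfrac52\tau_0(t)\big)\psi(t)+\big(2A-\tfrac52\tau_0(t)\big)\star_t\tau_3(t)+d\tau_3(t)+\tfrac52\varphi(t)\wedge d\tau_0(t),\quad d\psi(t)=0,\quad \varphi(0)=\varphi_0 .$$ -/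

import Mathlib

open scoped Manifold
open scoped ContDiff

noncomputable section

namespace G2

/-- The model space of a `7`-dimensional manifold. Its Euclidean inner product plays no role below:
it is used only as a `7`-dimensional real vector space. By definition in Mathlib, every tangent
space `TangentSpace (𝓡 7) x` of a `7`-manifold is a copy of it. -/
abbrev E7 : Type := EuclideanSpace ℝ (Fin 7)

/-- Alternating `k`-forms on a tangent space. -/
abbrev Cov (k : ℕ) : Type := E7 [⋀^Fin k]→L[ℝ] ℝ

/-! ### Linear algebra of alternating forms -/

/-- The wedge product, with the convention
`(α ∧ β)(v) = ∑ over (k,l)-shuffles σ of sign σ • α (v_σ1, …, v_σk) * β (v_σ(k+1), …, v_σ(k+l))`.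
The argument `h` only records the degree. -/
def wedge {k l m : ℕ} (h : k + l = m) (α : Cov k) (β : Cov l) : Cov m :=
  { toMultilinearMap := (AlternatingMap.domDomCongr (finSumFinEquiv.trans (finCongr h))
      ((LinearMap.mul' ℝ ℝ).compAlternatingMap
        (α.toAlternatingMap.domCoprod β.toAlternatingMap))).toMultilinearMap
    map_eq_zero_of_eq' := (AlternatingMap.domDomCongr (finSumFinEquiv.trans (finCongr h))
      ((LinearMap.mul' ℝ ℝ).compAlternatingMap
        (α.toAlternatingMap.domCoprod β.toAlternatingMap))).map_eq_zero_of_eq'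
    cont := by
      have key : ∀ σ : Equiv.Perm.ModSumCongr (Fin k) (Fin l),
          Continuous fun w : Fin k ⊕ Fin l → E7 =>
            (LinearMap.mul' ℝ ℝ) (AlternatingMap.domCoprod.summand
              α.toAlternatingMap β.toAlternatingMap σ w) := by
        intro σ
        induction σ using Quotient.inductionOn' with
        | h σ =>
          simp only [AlternatingMap.domCoprod.summand_mk'', _root_.smul_apply,
            MultilinearMap.domDomCongr_apply, MultilinearMap.domCoprod_apply,
            map_zsmul_unit, LinearMap.mul'_apply]
          apply Continuous.const_smul
          apply Continuous.mul
          · exact α.cont.comp (continuous_pi fun i => continuous_apply _)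
          · exact β.cont.comp (continuous_pi fun i => continuous_apply _)
      have h2 : Continuous fun v : Fin m → E7 =>
          ∑ σ : Equiv.Perm.ModSumCongr (Fin k) (Fin l),
            (LinearMap.mul' ℝ ℝ) (AlternatingMap.domCoprod.summand
              α.toAlternatingMap β.toAlternatingMap σ
                (fun i => v (finSumFinEquiv.trans (finCongr h) i))) :=
        continuous_finsetSum _ fun σ _ =>
          (key σ).comp (continuous_pi fun i => continuous_apply _)
      refine h2.congr fun v => ?_
      simp [AlternatingMap.domCoprod_apply, map_sum]
      rfl }

/-- The contraction `ι_X φ` of a `3`-form with a vector. -/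
def contract (X : E7) (φ : Cov 3) : Cov 2 := φ.curryLeft X

theorem append_update_right {k l : ℕ} [DecidableEq (Fin l)] (u : Fin k → E7) (w : Fin l → E7)
    (i : Fin l) (x : E7) :
    Fin.append u (Function.update w i x) =
      Function.update (Fin.append u w) (Fin.natAdd k i) x := by
  funext j
  refine Fin.addCases (fun a => ?_) (fun a => ?_) j
  · rw [Fin.append_left, Function.update_of_ne, Fin.append_left]
    intro h
    have := congrArg Fin.val h
    simp only [Fin.val_castAdd, Fin.val_natAdd] at this
    omega
  · rw [Fin.append_right]
    by_cases h : a = i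
    · subst h
      simp
    · rw [Function.update_of_ne h, Function.update_of_ne, Fin.append_right]
      intro h'
      exact h (Fin.natAdd_injective l k h')

/-- The contraction of a form with a tuple `u` of vectors, which fill its first slots. -/
def contractTuple {k l m : ℕ} (h : k + l = m) (u : Fin k → E7) (ν : Cov m) : Cov l :=
  { toFun := fun w => ν fun i => Fin.append u w (Fin.cast h.symm i)
    map_update_add' := by
      subst h
      intro _ w i x y
      simp only [Fin.cast_eq_self, append_update_right]
      exact ν.map_update_add _ _ _ _
    map_update_smul' := by
      subst h
      intro _ w i c x
      simp only [Fin.cast_eq_self, append_update_right]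
      exact ν.map_update_smul _ _ _ _
    map_eq_zero_of_eq' := by
      subst h
      intro w i j hw hij
      refine ν.map_eq_zero_of_eq _ (i := Fin.natAdd k i) (j := Fin.natAdd k j) ?_ ?_
      · simpa using hw
      · exact fun h' => hij (Fin.natAdd_injective l k h')
    cont := by
      subst h
      refine ν.cont.comp (continuous_pi fun j => ?_)
      simp only [Fin.cast_eq_self]
      refine Fin.addCases (fun a => ?_) (fun a => ?_) j
      · simp only [Fin.append_left]
        exact continuous_const
      · simp only [Fin.append_right]
        exact continuous_apply a }

/-- An auxiliary basis of the tangent space. -/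
def stdVec (i : Fin 7) : E7 := EuclideanSpace.single i 1

/-- The covector `e^(i+1)` (coordinates are numbered from `0`). -/
def coord (i : Fin 7) : Cov 1 :=
  ContinuousAlternatingMap.ofSubsingleton ℝ E7 ℝ 0 (EuclideanSpace.proj i)

/-- `e^i ∧ e^j ∧ e^k`. -/
def coord3 (i j k : Fin 7) : Cov 3 :=
  wedge (k := 2) (l := 1) rfl (wedge (k := 1) (l := 1) rfl (coord i) (coord j)) (coord k)

/-- The model `3`-form
`e^127 + e^347 + e^567 + e^135 - e^146 - e^236 - e^245` on `ℝ⁷`. -/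
def modelForm : Cov 3 :=
  coord3 0 1 6 + coord3 2 3 6 + coord3 4 5 6 + coord3 0 2 4
    - coord3 0 3 5 - coord3 1 2 5 - coord3 1 3 4

/-- A `3`-form on a tangent space is a `G₂` form if it is the model form in some coframe. -/
def IsG2 (φ : Cov 3) : Prop :=
  ∃ L : E7 ≃L[ℝ] E7, φ = modelForm.compContinuousLinearMap (L : E7 →L[ℝ] E7)

/-! ### Metric, volume form and Hodge star of a `G₂` form -/

/-- `g` is an inner product, `ν` is one of its two volume forms (the value of `ν` on a frame
squares to the Gram determinant of the frame), and
`g(X, Y) ν = (1/6) ι_X φ ∧ ι_Y φ ∧ φ` for all `X`, `Y`. -/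
structure IsMetricVolume (φ : Cov 3) (g : LinearMap.BilinForm ℝ E7) (ν : Cov 7) : Prop where
  symm : ∀ X Y, g X Y = g Y X
  pos : ∀ X, X ≠ 0 → 0 < g X X
  volume : ∀ v : Fin 7 → E7, ν v ^ 2 = (Matrix.of fun i j => g (v i) (v j)).det
  eq : ∀ X Y, g X Y • ν =
    (1 / 6 : ℝ) • wedge (k := 4) (l := 3) rfl
      (wedge (k := 2) (l := 2) rfl (contract X φ) (contract Y φ)) φ

/-- The pair of the metric `g_φ` and the volume form `vol_φ` (which records the orientation) that
a `G₂` form `φ` determines. Junk if `φ` is not a `G₂` form. -/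
def metricVolume (φ : Cov 3) : LinearMap.BilinForm ℝ E7 × Cov 7 :=
  Classical.epsilon fun p => IsMetricVolume φ p.1 p.2

/-- The metric `g_φ`. -/
def metric (φ : Cov 3) : LinearMap.BilinForm ℝ E7 := (metricVolume φ).1

/-- The volume form of `g_φ` and of the orientation induced by `φ`. -/
def vol (φ : Cov 3) : Cov 7 := (metricVolume φ).2

/-- Two `G₂` forms on one tangent space induce the same orientation. -/
def SameOrientation (φ φ' : Cov 3) : Prop := ∃ c : ℝ, 0 < c ∧ vol φ' = c • vol φ

/-- The inverse `g^{ij}` of the matrix of `g_φ` in the auxiliary basis `b`. -/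
def invGram (φ : Cov 3) : Matrix (Fin 7) (Fin 7) ℝ :=
  (Matrix.of fun i j => metric φ (stdVec i) (stdVec j))⁻¹

/-- The `g_φ`-dual basis `b^i = ∑ j, g^{ij} b_j` of the auxiliary basis `b`. -/
def dualVec (φ : Cov 3) (i : Fin 7) : E7 := ∑ j, invGram φ i j • stdVec j

/-- The Hodge star of the metric and orientation induced by `φ`:
`(⋆β)(w) = (1/k!) ∑_{i₁,…,i_k} β(b_{i₁}, …, b_{i_k}) vol_φ(b^{i₁}, …, b^{i_k}, w)`,
so that `α ∧ ⋆β = ⟨α, β⟩ vol_φ`. -/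
def star (φ : Cov 3) {k l : ℕ} (h : k + l = 7) (β : Cov k) : Cov l :=
  ((k.factorial : ℝ)⁻¹) • ∑ i : Fin k → Fin 7,
    β (fun a => stdVec (i a)) • contractTuple h (fun a => dualVec φ (i a)) (vol φ)

/-- The dual `4`-form `ψ = ⋆_φ φ`. -/
def dual (φ : Cov 3) : Cov 4 := star φ (k := 3) (l := 4) rfl φ

/-- The trace of a bilinear function with respect to `g_φ`. -/
def trace (φ : Cov 3) (B : E7 → E7 → ℝ) : ℝ :=
  ∑ i, ∑ j, invGram φ i j * B (stdVec i) (stdVec j)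

/-- The vector `U` with `g_φ(U, ·) = α`. -/
def sharp (φ : Cov 3) (α : Cov 1) : E7 := ∑ i, α (fun _ => stdVec i) • dualVec φ i

/-- The map `j_φ(γ)(X, Y) = ⋆(ι_X φ ∧ ι_Y φ ∧ γ)` from `3`-forms to `2`-tensors; the star is here
a `0`-form, which is read as a number. -/
def jMap (φ γ : Cov 3) (X Y : E7) : ℝ :=
  star φ (k := 7) (l := 0) rfl
    (wedge (k := 4) (l := 3) rfl
      (wedge (k := 2) (l := 2) rfl (contract X φ) (contract Y φ)) γ) ![]

/-- The full torsion tensor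
`τ = (1/4) τ₀ g_φ - ι_{τ₁} φ - (1/3) j_φ(τ₃) + (1/2) τ₂` at a point. -/
def fullTorsion (φ : Cov 3) (τ₀ : ℝ) (τ₁ : Cov 1) (τ₂ : Cov 2) (τ₃ : Cov 3) (X Y : E7) : ℝ :=
  1 / 4 * τ₀ * metric φ X Y - contract (sharp φ τ₁) φ ![X, Y] - 1 / 3 * jMap φ τ₃ X Y
    + 1 / 2 * τ₂ ![X, Y]

/-- Membership in `Λ²₁₄ = {α | α ∧ φ = -⋆α}`. -/
def Mem14 (φ : Cov 3) (α : Cov 2) : Prop :=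
  wedge (k := 2) (l := 3) rfl α φ = -star φ (k := 2) (l := 5) rfl α

/-- Membership in `Λ³₂₇ = {β | β ∧ φ = 0 = β ∧ ⋆φ}`. -/
def Mem27 (φ β : Cov 3) : Prop :=
  wedge (k := 3) (l := 3) (m := 6) rfl β φ = 0 ∧
    wedge (k := 3) (l := 4) (m := 7) rfl β (dual φ) = 0

/-! ### Differential forms on a `7`-manifold -/

section Manifold

variable {M : Type*} [TopologicalSpace M] [ChartedSpace E7 M]

/-- Not necessarily smooth differential `k`-forms: an alternating form on every tangent space
(`TangentSpace (𝓡 7) x` is `E7` by definition, through the preferred chart at `x`). -/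
abbrev Form (M : Type*) (k : ℕ) : Type _ := M → Cov k

/-- The expression of a form in the preferred chart around `p`: its pullback under the inverse
of the chart. -/
def localForm {k : ℕ} (η : Form M k) (p : M) (y : E7) : Cov k :=
  (η ((extChartAt (𝓡 7) p).symm y)).compContinuousLinearMap
    (mfderiv 𝓘(ℝ, E7) (𝓡 7) (extChartAt (𝓡 7) p).symm y)

/-- Smooth differential forms. -/
def IsSmooth {k : ℕ} (η : Form M k) : Prop :=
  ∀ p : M, ContDiffOn ℝ ∞ (localForm η p) (extChartAt (𝓡 7) p).target

/-- The exterior derivative, computed in the chart at the point. -/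
def d {k : ℕ} (η : Form M k) : Form M (k + 1) := fun x =>
  (extDeriv (localForm η x) (extChartAt (𝓡 7) x x)).compContinuousLinearMap
    (mfderiv (𝓡 7) 𝓘(ℝ, E7) (extChartAt (𝓡 7) x) x)

/-- The differential of a function, as a `1`-form. -/
def dFun (f : M → ℝ) : Form M 1 := fun x =>
  ContinuousAlternatingMap.ofSubsingleton ℝ E7 ℝ 0 (mfderiv (𝓡 7) 𝓘(ℝ, ℝ) f x)

/-- A `G₂` form on a manifold: a smooth `3`-form that is a `G₂` form on every tangent space. -/
structure IsG2Form (φ : Form M 3) : Prop where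
  smooth : IsSmooth φ
  isG2 : ∀ x, IsG2 (φ x)

/-- The Hodge star on differential forms. -/
def starF (φ : Form M 3) {k l : ℕ} (h : k + l = 7) (η : Form M k) : Form M l :=
  fun x => star (φ x) h (η x)

/-- The form `ψ = ⋆_φ φ`. -/
def dualF (φ : Form M 3) : Form M 4 := fun x => dual (φ x)

/-- A `G₂` form is coclosed if `dψ = 0`. -/
def IsCoclosed (φ : Form M 3) : Prop := d (dualF φ) = 0

/-- The codifferential `d* = (-1)^p ⋆ d ⋆` on `p`-forms of a Riemannian `7`-manifold,
with `p = k + 1`. -/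
def codiff (φ : Form M 3) {k l : ℕ} (h : (k + 1) + l = 7) (η : Form M (k + 1)) : Form M k :=
  (-1 : ℝ) ^ (k + 1) •
    starF φ (k := l + 1) (l := k) (by omega) (d (starF φ (k := k + 1) (l := l) h η))

/-- The Hodge Laplacian `Δ = d d* + d* d` of the metric `g_φ`, on `p`-forms with `p = k + 1`. -/
def laplacian (φ : Form M 3) {k l : ℕ} (h : (k + 1) + (l + 1) = 7) (η : Form M (k + 1)) :
    Form M (k + 1) :=
  d (codiff φ (k := k) (l := l + 1) h η)
    + codiff φ (k := k + 1) (l := l) (by omega) (d η)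

/-- The Hodge Laplacian `Δ_φ ψ` of `ψ = ⋆_φ φ`. -/
def laplacianDual (φ : Form M 3) : Form M 4 :=
  laplacian φ (k := 3) (l := 2) rfl (dualF φ)

/-- `τ₀, τ₁, τ₂, τ₃` are the intrinsic torsion forms of the `G₂` form `φ`:
`dφ = τ₀ ψ + 3 τ₁ ∧ φ + ⋆τ₃` and `dψ = 4 τ₁ ∧ ψ - ⋆τ₂`, where `τ₂` is in `Ω²₁₄` and `τ₃` is
in `Ω³₂₇`. -/
structure IsTorsion (φ : Form M 3) (τ₀ : M → ℝ) (τ₁ : Form M 1) (τ₂ : Form M 2)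
    (τ₃ : Form M 3) : Prop where
  smooth₀ : ContMDiff (𝓡 7) 𝓘(ℝ, ℝ) ∞ τ₀
  smooth₁ : IsSmooth τ₁
  smooth₂ : IsSmooth τ₂
  smooth₃ : IsSmooth τ₃
  mem14 : ∀ x, Mem14 (φ x) (τ₂ x)
  mem27 : ∀ x, Mem27 (φ x) (τ₃ x)
  d_form : ∀ x, d φ x = τ₀ x • dual (φ x)
    + (3 : ℝ) • wedge (k := 1) (l := 3) (m := 4) rfl (τ₁ x) (φ x)
    + star (φ x) (k := 3) (l := 4) rfl (τ₃ x)
  d_dual : ∀ x, d (dualF φ) x = (4 : ℝ) • wedge (k := 1) (l := 4) (m := 5) rfl (τ₁ x) (dual (φ x))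
    - star (φ x) (k := 2) (l := 5) rfl (τ₂ x)

/-- The trace of the full torsion tensor with respect to `g_φ`, as a function. -/
def traceTorsion (φ : Form M 3) (τ₀ : M → ℝ) (τ₁ : Form M 1) (τ₂ : Form M 2)
    (τ₃ : Form M 3) : M → ℝ := fun x =>
  trace (φ x) (fullTorsion (φ x) (τ₀ x) (τ₁ x) (τ₂ x) (τ₃ x))

/-! ### The coflows -/

/-- The family `η` of forms satisfies `∂η/∂t = R` on the time interval `I`. -/
def Evolves {k : ℕ} (I : Set ℝ) (η R : ℝ → Form M k) : Prop :=
  ∀ t ∈ I, ∀ x, HasDerivWithinAt (fun s => η s x) (R t x) I t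

/-- `φ(t)` solves the Laplacian coflow for `φ₀` on `I`:
`∂ψ/∂t = -Δ_t ψ`, `dψ(t) = 0`, `ψ(0) = ψ₀`. -/
structure IsLaplacianCoflow (I : Set ℝ) (φ₀ : Form M 3) (φ : ℝ → Form M 3) : Prop where
  evolution : Evolves I (fun t => dualF (φ t)) (fun t => -laplacianDual (φ t))
  closed : ∀ t ∈ I, d (dualF (φ t)) = 0
  initial : dualF (φ 0) = dualF φ₀

/-- `φ(t)`, with torsion forms `τ₀(t), …, τ₃(t)`, solves the modified Laplacian coflow with
constant `A` for `φ₀` on `I`: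
`∂ψ/∂t = Δ_t ψ + 2 d((A - Tr_t τ(t)) φ(t))`, `dψ(t) = 0`, `ψ(0) = ψ₀`. -/
structure IsModifiedCoflow (I : Set ℝ) (A : ℝ) (φ₀ : Form M 3) (φ : ℝ → Form M 3)
    (τ₀ : ℝ → M → ℝ) (τ₁ : ℝ → Form M 1) (τ₂ : ℝ → Form M 2) (τ₃ : ℝ → Form M 3) : Prop where
  evolution : Evolves I (fun t => dualF (φ t)) (fun t => laplacianDual (φ t) + (2 : ℝ) •
    d fun x => (A - traceTorsion (φ t) (τ₀ t) (τ₁ t) (τ₂ t) (τ₃ t) x) • φ t x)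
  closed : ∀ t ∈ I, d (dualF (φ t)) = 0
  initial : dualF (φ 0) = dualF φ₀

/-- The right-hand side `-dτ₀ ∧ φ - τ₀² ψ - τ₀ ⋆τ₃ - dτ₃`. -/
def rhsC (φ : Form M 3) (τ₀ : M → ℝ) (τ₃ : Form M 3) : Form M 4 := fun x =>
  -wedge (k := 1) (l := 3) (m := 4) rfl (dFun τ₀ x) (φ x)
    - τ₀ x ^ 2 • dual (φ x)
    - τ₀ x • star (φ x) (k := 3) (l := 4) rfl (τ₃ x)
    - d τ₃ x

/-- The right-hand side
`τ₀ (2A - 5/2 τ₀) ψ + (2A - 5/2 τ₀) ⋆τ₃ + dτ₃ + 5/2 φ ∧ dτ₀`. -/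
def rhsG (A : ℝ) (φ : Form M 3) (τ₀ : M → ℝ) (τ₃ : Form M 3) : Form M 4 := fun x =>
  (τ₀ x * (2 * A - 5 / 2 * τ₀ x)) • dual (φ x)
    + (2 * A - 5 / 2 * τ₀ x) • star (φ x) (k := 3) (l := 4) rfl (τ₃ x)
    + d τ₃ x
    + (5 / 2 : ℝ) • wedge (k := 3) (l := 1) (m := 4) rfl (φ x) (dFun τ₀ x)

end Manifold

end G2

end

noncomputable section

namespace G2

open Equiv Nat

/-! ### The wedge product as a sum over permutations -/

/-! Coclosedness forces τ₁ = 0. It says 4 τ₁ ∧ ψ = ⋆τ₂. If a is the vector dual to τ₁, then τ₁ ∧ ψ =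
⋆ι_aφ, so τ₂ = 4 ι_aφ; but ι_aφ ∧ φ = 2 ⋆ι_aφ while τ₂ ∧ φ = -⋆τ₂, hence ι_aφ = 0 and a = 0
(`eq_zero_of_wedge_dual`). So dφ = τ₀ψ + ⋆τ₃. As ⋆⋆ = 1 in dimension seven, d*ψ = ⋆dφ = τ₀φ + τ₃,
and the Leibniz rule gives Δψ = d(τ₀φ + τ₃) = dτ₀ ∧ φ + τ₀ dφ + dτ₃ (`laplacianDual_eq`).

In the trace of the torsion, g_φ contributes 7, the two skew terms contribute 0, and j_φ(τ₃) is
traceless: over an orthonormal frame ∑ ι_aφ ∧ ι_aφ = 6ψ, and ψ ∧ τ₃ = 0 (`trace_fullTorsion`).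
Expanding 2d((A - 7/4 τ₀)φ) by Leibniz then gives the modified right-hand side.

The right-hand sides therefore agree whenever dψ = 0, which both systems require, and only the
initial conditions remain to be compared. The forms φ and -φ have the same ψ, so ψ(0) = ψ₀
determines φ(0) only with the orientation. Given ψ and the volume form, ι_uψ ∧ ι_vψ = 2 ι_{u×v} vol
recovers the cross product, tr(u×(v×·)) = -6⟨u,v⟩ the metric, and φ(u,v,w) = ⟨u×v,w⟩ the form
(`pull_modelForm_eq`, `eq_of_dual_eq`).

All pointwise algebra is done for the model form: the wedge product is made computable on lists of
indices (`Rep.wedge`), the needed identities become finite checks on integers, and they are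
transported along a coframe L by the equivariance of metric, volume and star
(`IsMetricVolume.unique`, `star_pull`). -/

theorem factorial_smul_wedge {k l m : ℕ} (h : k + l = m) (α : Cov k) (β : Cov l)
    (v : Fin m → E7) :
    ((k ! * l ! : ℕ) : ℝ) * wedge h α β v =
      ∑ σ : Perm (Fin m), ((Perm.sign σ : ℤ) : ℝ) *
        (α (fun a => v (σ (Fin.cast h (Fin.castAdd l a)))) *
          β (fun b => v (σ (Fin.cast h (Fin.natAdd k b))))) := by
  subst h
  have key := congrArg (fun f => (LinearMap.mul' ℝ ℝ) (f fun i => v (finSumFinEquiv i)))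
    (MultilinearMap.domCoprod_alternization_eq α.toAlternatingMap β.toAlternatingMap)
  have hw : wedge rfl α β v = (LinearMap.mul' ℝ ℝ)
      ((α.toAlternatingMap.domCoprod β.toAlternatingMap) fun i => v (finSumFinEquiv i)) := rfl
  simp only [Fintype.card_fin, AlternatingMap.smul_apply, nsmul_eq_mul] at key
  rw [← nsmul_eq_mul, map_nsmul, ← hw, nsmul_eq_mul] at key
  rw [← key, MultilinearMap.alternatization_apply, map_sum]
  refine Fintype.sum_equiv (Equiv.permCongr finSumFinEquiv) _ _ fun σ => ?_
  rw [map_zsmul_unit, MultilinearMap.domDomCongr_apply, MultilinearMap.domCoprod_apply,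
    LinearMap.mul'_apply, Perm.sign_permCongr, Units.smul_def, zsmul_eq_mul]
  congr 1
  simp only [Equiv.permCongr_apply, Fin.cast_eq_self, finSumFinEquiv_symm_apply_castAdd,
    finSumFinEquiv_symm_apply_natAdd]
  rfl

/-- Permutations are sorted by the position p that they send to 0: `p.cycleRange` moves p to 0 and
keeps the order of the rest, after which e permutes the nonzero values. -/
theorem sum_perm_succ {n : ℕ} {R : Type*} [AddCommMonoid R] (F : Perm (Fin (n + 1)) → R) :
    ∑ σ, F σ = ∑ p : Fin (n + 1), ∑ e : Perm (Fin n),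
      F (Perm.decomposeFin.symm (0, e) * p.cycleRange) := by
  rw [← Fintype.sum_prod_type']
  refine (Function.Bijective.sum_comp (e := fun q : Fin (n + 1) × Perm (Fin n) =>
    Perm.decomposeFin.symm (0, q.2) * q.1.cycleRange) ?_ F).symm
  rw [Fintype.bijective_iff_surjective_and_card]
  refine ⟨fun σ => ?_, ?_⟩
  · obtain ⟨⟨q, e⟩, hq⟩ := Perm.decomposeFin.symm.surjective (σ * (σ.symm 0).cycleRange⁻¹)
    have h0 : q = 0 := by
      have := congrArg (fun τ : Perm (Fin (n + 1)) => τ 0) hq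
      simp only [Perm.decomposeFin_symm_apply_zero, Perm.mul_apply, Perm.inv_def,
        Fin.cycleRange_symm_zero, Equiv.apply_symm_apply] at this
      exact this
    subst h0
    exact ⟨(σ.symm 0, e), by simp [hq]⟩
  · simp [Fintype.card_perm, Nat.factorial_succ]

variable {k l m : ℕ}

theorem wedge_eq_of_factorial {h : k + l = m} {α : Cov k} {β : Cov l} {v : Fin m → E7} {r : ℝ}
    (H : ((k ! * l ! : ℕ) : ℝ) * r = ∑ σ : Perm (Fin m), ((Perm.sign σ : ℤ) : ℝ) *
        (α (fun a => v (σ (Fin.cast h (Fin.castAdd l a)))) *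
          β (fun b => v (σ (Fin.cast h (Fin.natAdd k b)))))) : wedge h α β v = r := by
  have h0 : ((k ! * l ! : ℕ) : ℝ) ≠ 0 := by positivity
  exact mul_left_cancel₀ h0 ((factorial_smul_wedge h α β v).trans H.symm)

/-! ### Bilinearity, pullback and contraction of the wedge product -/

theorem wedge_add_left (h : k + l = m) (α α' : Cov k) (β : Cov l) :
    wedge h (α + α') β = wedge h α β + wedge h α' β := by
  ext v
  apply wedge_eq_of_factorial
  simp only [ContinuousAlternatingMap.add_apply, mul_add, add_mul, Finset.sum_add_distrib,
    factorial_smul_wedge]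

theorem wedge_add_right (h : k + l = m) (α : Cov k) (β β' : Cov l) :
    wedge h α (β + β') = wedge h α β + wedge h α β' := by
  ext v
  apply wedge_eq_of_factorial
  simp only [ContinuousAlternatingMap.add_apply, mul_add, Finset.sum_add_distrib,
    factorial_smul_wedge]

theorem wedge_smul_left (h : k + l = m) (c : ℝ) (α : Cov k) (β : Cov l) :
    wedge h (c • α) β = c • wedge h α β := by
  ext v
  apply wedge_eq_of_factorial
  simp only [ContinuousAlternatingMap.smul_apply, smul_eq_mul]
  rw [mul_left_comm, factorial_smul_wedge, Finset.mul_sum]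
  exact Finset.sum_congr rfl fun _ _ => by ring

theorem wedge_smul_right (h : k + l = m) (c : ℝ) (α : Cov k) (β : Cov l) :
    wedge h α (c • β) = c • wedge h α β := by
  ext v
  apply wedge_eq_of_factorial
  simp only [ContinuousAlternatingMap.smul_apply, smul_eq_mul]
  rw [mul_left_comm, factorial_smul_wedge, Finset.mul_sum]
  exact Finset.sum_congr rfl fun _ _ => by ring

/-- The wedge product as a bilinear map. -/
def wedgeₗ (h : k + l = m) : Cov k →ₗ[ℝ] Cov l →ₗ[ℝ] Cov m :=
  LinearMap.mk₂ ℝ (wedge h) (wedge_add_left h) (wedge_smul_left h) (wedge_add_right h)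
    (wedge_smul_right h)

@[simp] theorem wedgeₗ_apply (h : k + l = m) (α : Cov k) (β : Cov l) :
    wedgeₗ h α β = wedge h α β := rfl

/-- The pullback of a form under a linear map. -/
abbrev pull (L : E7 →L[ℝ] E7) (α : Cov k) : Cov k := α.compContinuousLinearMap L

theorem pull_apply (L : E7 →L[ℝ] E7) (α : Cov k) (v : Fin k → E7) :
    pull L α v = α (fun i => L (v i)) := rfl

theorem pull_wedge (L : E7 →L[ℝ] E7) (h : k + l = m) (α : Cov k) (β : Cov l) :
    pull L (wedge h α β) = wedge h (pull L α) (pull L β) := by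
  ext v
  refine (wedge_eq_of_factorial ?_).symm
  exact factorial_smul_wedge h α β _

theorem wedge_zero_left (h : 0 + l = l) (α : Cov 0) (β : Cov l) :
    wedge h α β = α ![] • β := by
  ext v
  have h0 : ((0 ! * l ! : ℕ) : ℝ) ≠ 0 := by positivity
  apply wedge_eq_of_factorial
  rw [ContinuousAlternatingMap.smul_apply, smul_eq_mul]
  have : ∀ σ : Perm (Fin l), ((Perm.sign σ : ℤ) : ℝ) *
      (α (fun a => v (σ (Fin.cast h (Fin.castAdd l a)))) *
        β (fun b => v (σ (Fin.cast h (Fin.natAdd 0 b))))) = α ![] * β v := by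
    intro σ
    have h1 : (fun b => v (σ (Fin.cast h (Fin.natAdd 0 b)))) = v ∘ σ := by
      funext b; congr 2; ext; simp
    rw [h1, Subsingleton.elim (fun a => v (σ (Fin.cast h (Fin.castAdd l a)))) ![]]
    have := β.toAlternatingMap.map_perm v σ
    have h2 : β (v ∘ σ) = ((Perm.sign σ : ℤ) : ℝ) * β v := by
      refine this.trans ?_
      rw [Units.smul_def, zsmul_eq_mul]; rfl
    rw [h2]
    have h3 : ((Perm.sign σ : ℤ) : ℝ) * ((Perm.sign σ : ℤ) : ℝ) = 1 := by
      rw [← Int.cast_mul, ← Units.val_mul, Int.units_mul_self]; simp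
    linear_combination α ![] * β v * h3
  rw [Finset.sum_congr rfl fun σ _ => this σ]
  simp [Fintype.card_perm]

theorem wedge_zero_right (h : l + 0 = l) (α : Cov l) (β : Cov 0) :
    wedge h α β = β ![] • α := by
  ext v
  apply wedge_eq_of_factorial
  rw [ContinuousAlternatingMap.smul_apply, smul_eq_mul]
  have : ∀ σ : Perm (Fin l), ((Perm.sign σ : ℤ) : ℝ) *
      (α (fun a => v (σ (Fin.cast h (Fin.castAdd 0 a)))) *
        β (fun b => v (σ (Fin.cast h (Fin.natAdd l b))))) = β ![] * α v := by
    intro σ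
    have h1 : (fun b => v (σ (Fin.cast h (Fin.castAdd 0 b)))) = v ∘ σ := by
      funext b; congr 2
    rw [h1, Subsingleton.elim (fun a => v (σ (Fin.cast h (Fin.natAdd l a)))) ![]]
    have := α.toAlternatingMap.map_perm v σ
    have h2 : α (v ∘ σ) = ((Perm.sign σ : ℤ) : ℝ) * α v := by
      refine this.trans ?_
      rw [Units.smul_def, zsmul_eq_mul]; rfl
    rw [h2]
    have h3 : ((Perm.sign σ : ℤ) : ℝ) * ((Perm.sign σ : ℤ) : ℝ) = 1 := by
      rw [← Int.cast_mul, ← Units.val_mul, Int.units_mul_self]; simp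
    linear_combination α v * β ![] * h3
  rw [Finset.sum_congr rfl fun σ _ => this σ]
  simp [Fintype.card_perm]

/-- Contraction with a vector is an antiderivation of the wedge product. -/
theorem curryLeft_wedge (h : (k + 1) + (l + 1) = m + 1) (h₁ : k + (l + 1) = m)
    (h₂ : (k + 1) + l = m) (α : Cov (k + 1)) (β : Cov (l + 1)) (x : E7) :
    (wedge h α β).curryLeft x = wedge h₁ (α.curryLeft x) β
      + (-1 : ℝ) ^ (k + 1) • wedge h₂ α (β.curryLeft x) := by
  ext v
  rw [ContinuousAlternatingMap.add_apply, ContinuousAlternatingMap.smul_apply, smul_eq_mul]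
  change wedge h α β (Matrix.vecCons x v) = _
  apply wedge_eq_of_factorial
  subst h₁
  rw [sum_perm_succ]
  have e1 := factorial_smul_wedge rfl (α.curryLeft x) β v
  have e2 := factorial_smul_wedge h₂ α (β.curryLeft x) v
  -- The slot p that receives x belongs either to α or to β; these two cases give the two terms of
  -- the rule.
  have hsplit : ∀ G : Fin (k + (l + 1) + 1) → ℝ, ∑ p, G p =
      (∑ a : Fin (k + 1), G (Fin.cast h (Fin.castAdd (l + 1) a))) +
        ∑ b : Fin (l + 1), G (Fin.cast h (Fin.natAdd (k + 1) b)) := by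
    intro G
    rw [← Fin.sum_univ_add (fun i => G (Fin.cast h i))]
    exact (Fintype.sum_equiv (finCongr h) _ _ fun _ => rfl).symm
  have hsign : ∀ (e : Perm (Fin (k + (l + 1)))) (p : Fin (k + (l + 1) + 1)),
      ((Perm.sign (Perm.decomposeFin.symm (0, e) * p.cycleRange) : ℤ) : ℝ) =
        ((Perm.sign e : ℤ) : ℝ) * (-1) ^ (p : ℕ) := by
    intro e p
    rw [Perm.sign_mul, Perm.decomposeFin.symm_sign, Fin.sign_cycleRange]
    simp
  have hval : ∀ (e : Perm (Fin (k + (l + 1)))) (p : Fin (k + (l + 1) + 1)) (j),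
      (Matrix.vecCons x v) ((Perm.decomposeFin.symm (0, e) * p.cycleRange) (p.succAbove j)) =
        v (e j) := by
    intro e p j
    simp [Fin.cycleRange_succAbove]
  have hval0 : ∀ (e : Perm (Fin (k + (l + 1)))) (p : Fin (k + (l + 1) + 1)),
      (Matrix.vecCons x v) ((Perm.decomposeFin.symm (0, e) * p.cycleRange) p) = x := by
    intro e p
    simp
  rw [hsplit]
  -- Moving x to the front of α costs (-1)^a, which cancels the sign of the cycle. The k + 1
  -- positions contribute equally and turn k! into (k + 1)!.
  have hA : ∀ a : Fin (k + 1), ∑ e : Perm (Fin (k + (l + 1))),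
      ((Perm.sign (Perm.decomposeFin.symm (0, e) *
        (Fin.cast h (Fin.castAdd (l + 1) a)).cycleRange) : ℤ) : ℝ) *
      (α (fun a' => Matrix.vecCons x v ((Perm.decomposeFin.symm (0, e) *
        (Fin.cast h (Fin.castAdd (l + 1) a)).cycleRange) (Fin.cast h (Fin.castAdd (l + 1) a')))) *
       β (fun b => Matrix.vecCons x v ((Perm.decomposeFin.symm (0, e) *
        (Fin.cast h (Fin.castAdd (l + 1) a)).cycleRange) (Fin.cast h (Fin.natAdd (k + 1) b))))) =
      ((k ! * (l + 1)! : ℕ) : ℝ) * wedge rfl (α.curryLeft x) β v := by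
    intro a
    rw [e1]
    refine Finset.sum_congr rfl fun e _ => ?_
    rw [hsign]
    have hα : (fun a' => Matrix.vecCons x v ((Perm.decomposeFin.symm (0, e) *
        (Fin.cast h (Fin.castAdd (l + 1) a)).cycleRange) (Fin.cast h (Fin.castAdd (l + 1) a')))) =
        a.insertNth x (fun j => v (e (Fin.cast rfl (Fin.castAdd (l + 1) j)))) := by
      rw [Fin.eq_insertNth_iff]
      refine ⟨hval0 e _, funext fun j => ?_⟩
      rw [Fin.removeNth]
      have : Fin.cast h (Fin.castAdd (l + 1) (a.succAbove j)) =
          (Fin.cast h (Fin.castAdd (l + 1) a)).succAbove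
            (Fin.cast rfl (Fin.castAdd (l + 1) j)) := by
        ext
        simp only [Fin.succAbove, Fin.lt_def]
        split_ifs <;> simp_all <;> omega
      rw [this, hval]
    have hβ : (fun b => Matrix.vecCons x v ((Perm.decomposeFin.symm (0, e) *
        (Fin.cast h (Fin.castAdd (l + 1) a)).cycleRange) (Fin.cast h (Fin.natAdd (k + 1) b)))) =
        (fun b => v (e (Fin.cast rfl (Fin.natAdd k b)))) := by
      funext b
      have : Fin.cast h (Fin.natAdd (k + 1) b) =
          (Fin.cast h (Fin.castAdd (l + 1) a)).succAbove (Fin.cast rfl (Fin.natAdd k b)) := by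
        ext
        have := a.isLt
        simp only [Fin.succAbove, Fin.lt_def]
        split_ifs <;> simp_all <;> omega
      rw [this, hval]
    rw [hα, hβ, ContinuousAlternatingMap.map_insertNth]
    have h3 : ((-1 : ℝ) ^ (a : ℕ)) * (-1) ^ (a : ℕ) = 1 := by
      rw [← mul_pow]; simp
    simp only [Fin.val_cast, Fin.val_castAdd, ContinuousAlternatingMap.curryLeft_apply_apply]
    linear_combination (((Perm.sign e : ℤ) : ℝ) * α (Matrix.vecCons x
      (fun j => v (e (Fin.cast rfl (Fin.castAdd (l + 1) j))))) *
      β (fun b => v (e (Fin.cast rfl (Fin.natAdd k b))))) * h3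
  -- Here the cycle has sign (-1)^(k + 1 + b), and only (-1)^b is absorbed inside β; the rest is the
  -- sign of the antiderivation.
  have hB : ∀ b : Fin (l + 1), ∑ e : Perm (Fin (k + (l + 1))),
      ((Perm.sign (Perm.decomposeFin.symm (0, e) *
        (Fin.cast h (Fin.natAdd (k + 1) b)).cycleRange) : ℤ) : ℝ) *
      (α (fun a' => Matrix.vecCons x v ((Perm.decomposeFin.symm (0, e) *
        (Fin.cast h (Fin.natAdd (k + 1) b)).cycleRange) (Fin.cast h (Fin.castAdd (l + 1) a')))) *
       β (fun b' => Matrix.vecCons x v ((Perm.decomposeFin.symm (0, e) *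
        (Fin.cast h (Fin.natAdd (k + 1) b)).cycleRange) (Fin.cast h (Fin.natAdd (k + 1) b'))))) =
      (-1) ^ (k + 1) * (((k + 1)! * l ! : ℕ) * wedge h₂ α (β.curryLeft x) v) := by
    intro b
    rw [e2, Finset.mul_sum]
    refine Finset.sum_congr rfl fun e _ => ?_
    rw [hsign]
    have hβ : (fun b' => Matrix.vecCons x v ((Perm.decomposeFin.symm (0, e) *
        (Fin.cast h (Fin.natAdd (k + 1) b)).cycleRange) (Fin.cast h (Fin.natAdd (k + 1) b')))) =
        b.insertNth x (fun j => v (e (Fin.cast h₂ (Fin.natAdd (k + 1) j)))) := by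
      rw [Fin.eq_insertNth_iff]
      refine ⟨hval0 e _, funext fun j => ?_⟩
      rw [Fin.removeNth]
      have : Fin.cast h (Fin.natAdd (k + 1) (b.succAbove j)) =
          (Fin.cast h (Fin.natAdd (k + 1) b)).succAbove
            (Fin.cast h₂ (Fin.natAdd (k + 1) j)) := by
        ext
        simp only [Fin.succAbove, Fin.lt_def]
        split_ifs <;> simp_all <;> omega
      rw [this, hval]
    have hα : (fun a' => Matrix.vecCons x v ((Perm.decomposeFin.symm (0, e) *
        (Fin.cast h (Fin.natAdd (k + 1) b)).cycleRange) (Fin.cast h (Fin.castAdd (l + 1) a')))) =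
        (fun a' => v (e (Fin.cast h₂ (Fin.castAdd l a')))) := by
      funext a'
      have : Fin.cast h (Fin.castAdd (l + 1) a') =
          (Fin.cast h (Fin.natAdd (k + 1) b)).succAbove (Fin.cast h₂ (Fin.castAdd l a')) := by
        ext
        have := a'.isLt
        simp only [Fin.succAbove, Fin.lt_def]
        split_ifs <;> simp_all <;> omega
      rw [this, hval]
    rw [hα, hβ, ContinuousAlternatingMap.map_insertNth]
    have h3 : ((-1 : ℝ) ^ (b : ℕ)) * (-1) ^ (b : ℕ) = 1 := by
      rw [← mul_pow]; simp
    simp only [Fin.val_cast, Fin.val_natAdd, ContinuousAlternatingMap.curryLeft_apply_apply,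
      pow_add _ (k + 1) (b : ℕ)]
    linear_combination (((Perm.sign e : ℤ) : ℝ) * (-1) ^ (k + 1) *
      α (fun a' => v (e (Fin.cast h₂ (Fin.castAdd l a')))) * β (Matrix.vecCons x
      (fun j => v (e (Fin.cast h₂ (Fin.natAdd (k + 1) j)))))) * h3
  rw [Finset.sum_congr rfl fun a _ => hA a, Finset.sum_congr rfl fun b _ => hB b]
  simp only [Finset.sum_const, Finset.card_univ, Fintype.card_fin, nsmul_eq_mul,
    Nat.factorial_succ]
  push_cast
  ring

end G2
end

noncomputable section

namespace G2

open Equiv Nat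

variable {k l m : ℕ}

/-! ### Values of forms on the standard frame -/

theorem stdVec_apply (i j : Fin 7) : stdVec i j = if j = i then 1 else 0 := by
  simp [stdVec]

theorem sum_smul_stdVec (v : E7) : ∑ i, v i • stdVec i = v := by
  ext j
  simp [stdVec_apply]

/-- The standard frame as a basis. -/
def stdBasis : Module.Basis (Fin 7) ℝ E7 := (EuclideanSpace.basisFun (Fin 7) ℝ).toBasis

theorem stdBasis_apply (i : Fin 7) : stdBasis i = stdVec i := by
  simp [stdBasis, stdVec]

/-- The value of a form on the standard vectors with the given indices. -/
def evalL (α : Cov k) (is : List (Fin 7)) : ℝ := α fun a => stdVec (is.getD a 0)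

theorem evalL_ofFn (α : Cov k) (f : Fin k → Fin 7) :
    evalL α (List.ofFn f) = α fun a => stdVec (f a) := by
  unfold evalL
  congr 1
  funext a
  simp

theorem evalL_curryLeft (α : Cov (k + 1)) (i : Fin 7) (is : List (Fin 7)) :
    evalL (α.curryLeft (stdVec i)) is = evalL α (i :: is) := by
  unfold evalL
  rw [ContinuousAlternatingMap.curryLeft_apply_apply]
  congr 1
  funext a
  refine Fin.cases ?_ (fun b => ?_) a
  · simp
  · simp

@[simp] theorem evalL_add (α β : Cov k) (is : List (Fin 7)) :
    evalL (α + β) is = evalL α is + evalL β is := rfl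

@[simp] theorem evalL_sub (α β : Cov k) (is : List (Fin 7)) :
    evalL (α - β) is = evalL α is - evalL β is := rfl

@[simp] theorem evalL_smul (c : ℝ) (α : Cov k) (is : List (Fin 7)) :
    evalL (c • α) is = c * evalL α is := rfl

@[simp] theorem evalL_sum {ι : Type*} (s : Finset ι) (α : ι → Cov k) (is : List (Fin 7)) :
    evalL (∑ i ∈ s, α i) is = ∑ i ∈ s, evalL (α i) is := by
  simp [evalL, ContinuousAlternatingMap.sum_apply]

theorem ofFn_mem_sublistsLen {f : Fin k → Fin 7} (hf : StrictMono f) :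
    List.ofFn f ∈ (List.finRange 7).sublistsLen k := by
  rw [List.mem_sublistsLen]
  refine ⟨?_, List.length_ofFn⟩
  have h1 : (List.ofFn f).SortedLT := by
    simpa [List.sortedLT_ofFn_iff] using hf
  refine List.sublist_of_subperm_of_pairwise (r := (· < ·)) ?_ h1.pairwise
    (List.sortedLT_finRange 7).pairwise
  exact List.subperm_of_subset (List.nodup_ofFn.2 hf.injective) fun x _ => List.mem_finRange x

/-- Two forms agree if they agree on the standard vectors with increasing indices. -/
theorem cov_ext {α β : Cov k}
    (h : ∀ is ∈ (List.finRange 7).sublistsLen k, evalL α is = evalL β is) : α = β := by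
  apply ContinuousAlternatingMap.toAlternatingMap_injective
  refine Module.Basis.ext_alternating stdBasis fun v hv => ?_
  simp only [stdBasis_apply]
  set σ := Tuple.sort v
  have hmono : StrictMono (v ∘ σ) :=
    (Tuple.monotone_sort v).strictMono_of_injective (hv.comp σ.injective)
  have key := h _ (ofFn_mem_sublistsLen hmono)
  rw [evalL_ofFn, evalL_ofFn] at key
  have hα := α.toAlternatingMap.map_perm (fun a => stdVec (v a)) σ
  have hβ := β.toAlternatingMap.map_perm (fun a => stdVec (v a)) σ
  have key' : α.toAlternatingMap ((fun a => stdVec (v a)) ∘ σ) =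
    β.toAlternatingMap ((fun a => stdVec (v a)) ∘ σ) := key
  rw [hα, hβ] at key'
  exact smul_left_cancel _ key'

theorem cov_perm (α : Cov k) (v : Fin k → E7) (σ : Perm (Fin k)) :
    α (fun a => v (σ a)) = ((Perm.sign σ : ℤ) : ℝ) * α v := by
  refine (α.toAlternatingMap.map_perm v σ).trans ?_
  rw [Units.smul_def, zsmul_eq_mul]
  rfl

theorem cov_eq_zero_of_not_injective (α : Cov k) {v : Fin k → E7}
    (hv : ¬Function.Injective v) : α v = 0 :=
  α.toAlternatingMap.map_eq_zero_of_not_injective v hv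

/-- The function `a` on lists of indices gives the integral components of the form `α`. -/
def Rep (α : Cov k) (a : List (Fin 7) → ℤ) : Prop :=
  ∀ is : List (Fin 7), is.length = k → evalL α is = a is

/-- The components of a wedge product in terms of those of its factors. -/
def wedgeL : ℕ → ℕ → (List (Fin 7) → ℤ) → (List (Fin 7) → ℤ) → List (Fin 7) → ℤ
  | 0, _, a, b, is => a [] * b is
  | _ + 1, 0, a, b, is => a is * b []
  | _ + 1, _ + 1, _, _, [] => 0
  | k + 1, l + 1, a, b, i :: is =>
    wedgeL k (l + 1) (fun js => a (i :: js)) b is +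
      (if k % 2 = 0 then -wedgeL (k + 1) l a (fun js => b (i :: js)) is
        else wedgeL (k + 1) l a (fun js => b (i :: js)) is)

theorem Rep.curryLeft {α : Cov (k + 1)} {a : List (Fin 7) → ℤ} (h : Rep α a) (i : Fin 7) :
    Rep (α.curryLeft (stdVec i)) fun js => a (i :: js) := by
  intro is his
  rw [evalL_curryLeft, h _ (by simp [his])]

theorem Rep.contract {α : Cov 3} {a : List (Fin 7) → ℤ} (h : Rep α a) (i : Fin 7) :
    Rep (contract (stdVec i) α) fun js => a (i :: js) := h.curryLeft i

theorem Rep.add {α β : Cov k} {a b : List (Fin 7) → ℤ} (hα : Rep α a) (hβ : Rep β b) :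
    Rep (α + β) fun is => a is + b is := by
  intro is his
  rw [evalL_add, hα is his, hβ is his, Int.cast_add]

theorem Rep.sub {α β : Cov k} {a b : List (Fin 7) → ℤ} (hα : Rep α a) (hβ : Rep β b) :
    Rep (α - β) fun is => a is - b is := by
  intro is his
  rw [evalL_sub, hα is his, hβ is his, Int.cast_sub]

theorem evalL_nil (α : Cov 0) : evalL α [] = α ![] := by
  unfold evalL
  congr 1
  exact Subsingleton.elim _ _

/-- Induction on the total degree, peeling off the first index with the antiderivation rule, which
is the recursion of `wedgeL`. -/
theorem Rep.wedge {α : Cov k} {β : Cov l} {a b : List (Fin 7) → ℤ} (hα : Rep α a)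
    (hβ : Rep β b) (h : k + l = m) : Rep (wedge h α β) (wedgeL k l a b) := by
  induction m generalizing k l α β a b with
  | zero =>
    obtain rfl : k = 0 := by omega
    obtain rfl : l = 0 := by omega
    intro is his
    rw [wedge_zero_left, evalL_smul, hβ is his, ← evalL_nil, hα [] rfl, wedgeL, Int.cast_mul]
  | succ m ih =>
    intro is his
    rcases k with _ | k
    · obtain rfl : l = m + 1 := by omega
      rw [wedge_zero_left, evalL_smul, hβ is his, ← evalL_nil, hα [] rfl, wedgeL, Int.cast_mul]
    rcases l with _ | l
    · obtain rfl : k = m := by omega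
      rw [wedge_zero_right, evalL_smul, hα is his, ← evalL_nil, hβ [] rfl, wedgeL, Int.cast_mul,
        mul_comm]
    rcases is with _ | ⟨i, is⟩
    · simp at his
    have his' : is.length = m := by simpa using his
    rw [← evalL_curryLeft, curryLeft_wedge h (by omega) (by omega), evalL_add, evalL_smul,
      ih (hα.curryLeft i) hβ _ is his', ih hα (hβ.curryLeft i) _ is his', wedgeL]
    split_ifs with hk
    · rw [Odd.neg_one_pow (Nat.even_iff.2 hk).add_one]
      push_cast; ring
    · rw [Even.neg_one_pow (Nat.not_even_iff_odd.1 (fun h => hk (Nat.even_iff.1 h))).add_one]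
      push_cast; ring

/-- The components of a coordinate covector. -/
def coordL (i : Fin 7) : List (Fin 7) → ℤ
  | j :: _ => if i = j then 1 else 0
  | [] => 0

theorem coord_apply (i : Fin 7) (v : Fin 1 → E7) : coord i v = v 0 i := by
  simp [coord]

theorem rep_coord (i : Fin 7) : Rep (coord i) (coordL i) := by
  intro is his
  rcases is with _ | ⟨j, is⟩
  · simp at his
  rw [evalL, coord_apply]
  simp [stdVec_apply, coordL]

/-! ### The standard volume form and Hodge star -/

/-- The determinant of the coordinates of seven vectors. -/
def detForm : E7 [⋀^Fin 7]→ₗ[ℝ] ℝ :=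
  (Matrix.detRowAlternating (R := ℝ) (n := Fin 7)).compLinearMap
    (WithLp.linearEquiv 2 ℝ (Fin 7 → ℝ)).toLinearMap

theorem detForm_apply (v : Fin 7 → E7) : detForm v = (Matrix.of fun i j => v i j).det := by
  rw [detForm, AlternatingMap.compLinearMap_apply]
  exact congrArg _ rfl

theorem continuous_detForm : Continuous fun v => detForm v := by
  simp only [detForm_apply]
  apply Continuous.matrix_det
  exact continuous_pi fun i => continuous_pi fun j => by
    simp only [Matrix.of_apply]
    fun_prop

theorem exists_stdVol : ∃ ν : Cov 7, ∀ v, ν v = (Matrix.of fun i j => v i j).det :=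
  ⟨{ toMultilinearMap := detForm.toMultilinearMap
     map_eq_zero_of_eq' := detForm.map_eq_zero_of_eq'
     cont := continuous_detForm }, detForm_apply⟩

/-- The standard volume form, the determinant of the coordinates. It is obtained by choice only to
prevent its values from being unfolded. -/
def stdVol : Cov 7 := exists_stdVol.choose

theorem stdVol_apply (v : Fin 7 → E7) : stdVol v = (Matrix.of fun i j => v i j).det :=
  exists_stdVol.choose_spec v

/-- The sign of a list of indices: `0` if it has repetitions, and otherwise `1` or `-1` according
to the parity of the number of its inversions. -/
def sgnL : List (Fin 7) → ℤ
  | [] => 1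
  | i :: is => (is.foldr (fun j s => if i < j then s else if j < i then -s else 0) 1) * sgnL is

/-- Puts the inversion count in the shape of `Perm.sign_eq_prod_prod_Ioi`, so that it can be
compared with the determinant. -/
theorem sgnL_ofFn (f : Fin k → Fin 7) :
    sgnL (List.ofFn f) = ∏ i, ∏ j ∈ Finset.Ioi i,
      (if f i < f j then 1 else if f j < f i then -1 else 0) := by
  induction k with
  | zero => simp [sgnL]
  | succ k ih =>
    have hfold : ∀ (i : Fin 7) (is : List (Fin 7)),
        is.foldr (fun j s => if i < j then s else if j < i then -s else 0) (1 : ℤ) =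
        (is.map fun j => if i < j then 1 else if j < i then -1 else 0).prod := by
      intro i is
      induction is with
      | nil => rfl
      | cons j is ih =>
        rw [List.foldr_cons, List.map_cons, List.prod_cons, ih]
        split_ifs <;> simp
    rw [List.ofFn_succ, sgnL, ih, hfold, Fin.prod_univ_succ, Fin.prod_Ioi_zero, List.map_ofFn,
      List.prod_ofFn]
    simp only [Fin.prod_Ioi_succ, Function.comp_apply]

theorem stdVol_stdVec (f : Fin 7 → Fin 7) : stdVol (fun i => stdVec (f i)) = sgnL (List.ofFn f) := by
  by_cases hf : Function.Injective f
  · let σ : Perm (Fin 7) := Equiv.ofBijective f (Finite.injective_iff_bijective.1 hf)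
    have h2 : stdVol stdVec = 1 := by
      rw [stdVol_apply]
      have : (Matrix.of fun i j => stdVec i j) = (1 : Matrix (Fin 7) (Fin 7) ℝ) := by
        ext i j
        simp [stdVec_apply, Matrix.one_apply, eq_comm]
      rw [this, Matrix.det_one]
    have h3 : stdVol (fun i => stdVec (f i)) = ((Perm.sign σ : ℤ) : ℝ) := by
      refine (cov_perm stdVol stdVec σ).trans ?_
      rw [h2, mul_one]
    rw [h3, sgnL_ofFn, Perm.sign_eq_prod_prod_Ioi]
    push_cast
    refine Finset.prod_congr rfl fun i _ => Finset.prod_congr rfl fun j hj => ?_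
    have hij : f i ≠ f j := fun h => (Finset.mem_Ioi.1 hj).ne (hf h)
    have hσ : ∀ i, σ i = f i := fun i => rfl
    simp only [hσ]
    split_ifs with h1 h2
    · simp
    · simp
    · exact absurd (le_antisymm (not_lt.1 h2) (not_lt.1 h1)) hij
  · have h0 : stdVol (fun i => stdVec (f i)) = 0 := by
      refine cov_eq_zero_of_not_injective _ fun h => hf ?_
      exact fun i j hij => h (congrArg stdVec hij)
    rw [h0, sgnL_ofFn]
    obtain ⟨i, j, hij, hne⟩ : ∃ i j, f i = f j ∧ i < j := by
      simp only [Function.Injective, not_forall] at hf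
      obtain ⟨i, j, h, hne⟩ := hf
      rcases lt_or_gt_of_ne hne with h' | h'
      · exact ⟨i, j, h, h'⟩
      · exact ⟨j, i, h.symm, h'⟩
    rw [Finset.prod_eq_zero (Finset.mem_univ i)]
    · simp
    · exact Finset.prod_eq_zero (Finset.mem_Ioi.2 hne) (by simp [hij])

theorem rep_stdVol : Rep stdVol sgnL := by
  intro is his
  have : is = List.ofFn (fun a : Fin 7 => is.getD a 0) := by
    apply List.ext_getElem
    · rw [his, List.length_ofFn]
    · intro i h1 h2
      rw [List.getElem_ofFn, List.getD_eq_getElem]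
  conv_rhs => rw [this]
  exact stdVol_stdVec _

theorem stdVol_stdVec_self : stdVol stdVec = 1 := by
  have := stdVol_stdVec id
  rw [show sgnL (List.ofFn id) = 1 by decide] at this
  simpa using this

/-- The Hodge star of the standard metric and orientation. -/
def stdStar (h : k + l = 7) (β : Cov k) : Cov l :=
  ((k.factorial : ℝ)⁻¹) • ∑ i : Fin k → Fin 7,
    β (fun a => stdVec (i a)) • contractTuple h (fun a => stdVec (i a)) stdVol

theorem stdStar_apply (h : k + l = 7) (β : Cov k) (w : Fin l → E7) :
    stdStar h β w = ((k.factorial : ℝ)⁻¹) * ∑ i : Fin k → Fin 7, β (fun a => stdVec (i a)) *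
      stdVol fun j => Fin.append (fun a => stdVec (i a)) w (Fin.cast h.symm j) := by
  rw [stdStar, ContinuousAlternatingMap.smul_apply, ContinuousAlternatingMap.sum_apply]
  rfl

theorem append_stdVec (c : Fin k → Fin 7) (w : Fin l → Fin 7) :
    Fin.append (fun a => stdVec (c a)) (fun b => stdVec (w b)) =
      fun j => stdVec (Fin.append c w j) := by
  funext j
  refine Fin.addCases (fun a => ?_) (fun a => ?_) j <;> simp

/-- Only the rearrangements of c survive in the sum, since any other tuple repeats an index or meets
w. The k! survivors are equal, because β and the volume form change by the same sign, and they
cancel the 1/k!. -/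
theorem stdStar_stdVec (h : k + l = 7) (β : Cov k) (c : Fin k → Fin 7) (w : Fin l → Fin 7)
    (hb : Function.Injective (Fin.append c w)) :
    stdStar h β (fun b => stdVec (w b)) =
      stdVol (fun j => stdVec (Fin.append c w (Fin.cast h.symm j))) *
        β (fun a => stdVec (c a)) := by
  classical
  have hc : Function.Injective c := fun a a' haa' => by
    have := @hb (Fin.castAdd l a) (Fin.castAdd l a') (by simpa using haa')
    simpa using this
  have hsurj : Function.Surjective (Fin.append c w) :=
    ((Fintype.bijective_iff_injective_and_card _).2 ⟨hb, by simp [h]⟩).2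
  rw [stdStar_apply]
  simp only [append_stdVec]
  have hinj : Function.Injective fun σ : Perm (Fin k) => c ∘ σ := fun σ τ hστ =>
    Equiv.ext fun a => hc (congrFun hστ a)
  rw [← Finset.sum_subset (Finset.subset_univ
    (Finset.univ.image fun σ : Perm (Fin k) => c ∘ σ)), Finset.sum_image hinj.injOn]
  · have hterm : ∀ σ : Perm (Fin k), β (fun a => stdVec ((c ∘ σ) a)) *
        stdVol (fun j => stdVec (Fin.append (c ∘ σ) w (Fin.cast h.symm j))) =
        stdVol (fun j => stdVec (Fin.append c w (Fin.cast h.symm j))) *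
          β (fun a => stdVec (c a)) := by
      intro σ
      let τ : Perm (Fin 7) := (finSumFinEquiv.trans (finCongr h)).permCongr (Perm.sumCongr σ 1)
      have hτ : (fun j => stdVec (Fin.append (c ∘ σ) w (Fin.cast h.symm j))) =
          (fun j => stdVec (Fin.append c w (Fin.cast h.symm j))) ∘ τ := by
        funext j
        obtain ⟨j, rfl⟩ := (finCongr h).surjective j
        simp only [Function.comp_apply, τ, Equiv.permCongr_apply, finCongr_apply]
        refine Fin.addCases (fun a => ?_) (fun a => ?_) j <;> simp
      have hsgn : Perm.sign τ = Perm.sign σ := by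
        simp [τ, Perm.sign_permCongr]
      have h1' : β (fun a => stdVec ((c ∘ σ) a)) =
          ((Perm.sign σ : ℤ) : ℝ) * β (fun a => stdVec (c a)) :=
        cov_perm β (fun a => stdVec (c a)) σ
      have h2' : stdVol (fun j => stdVec (Fin.append (c ∘ σ) w (Fin.cast h.symm j))) =
          ((Perm.sign σ : ℤ) : ℝ) *
            stdVol (fun j => stdVec (Fin.append c w (Fin.cast h.symm j))) := by
        rw [hτ, ← hsgn]
        exact cov_perm stdVol (fun j => stdVec (Fin.append c w (Fin.cast h.symm j))) τ
      have h3 : ((Perm.sign σ : ℤ) : ℝ) * ((Perm.sign σ : ℤ) : ℝ) = 1 := by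
        rw [← Int.cast_mul, ← Units.val_mul, Int.units_mul_self]; simp
      rw [h1', h2']
      linear_combination (stdVol (fun j => stdVec (Fin.append c w (Fin.cast h.symm j))) *
          β (fun a => stdVec (c a))) * h3
    rw [Finset.sum_congr rfl fun σ _ => hterm σ]
    have h0 : (k ! : ℝ) ≠ 0 := by positivity
    simp [Fintype.card_perm, h0]
  · intro i _ hi
    have : stdVol (fun j => stdVec (Fin.append i w (Fin.cast h.symm j))) = 0 := by
      refine cov_eq_zero_of_not_injective _ fun hinj' => hi ?_
      have hiw : Function.Injective (Fin.append i w) := fun x y hxy => by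
        have := @hinj' (Fin.cast h x) (Fin.cast h y) (by simp [hxy])
        simpa using this
      have hex : ∀ a, ∃ a', c a' = i a := by
        intro a
        obtain ⟨j, hj⟩ := hsurj (i a)
        induction j using Fin.addCases with
        | left a' => exact ⟨a', by simpa using hj⟩
        | right b =>
          have := @hiw (Fin.castAdd l a) (Fin.natAdd k b) (by simpa using hj.symm)
          have := congrArg Fin.val this
          simp only [Fin.val_castAdd, Fin.val_natAdd] at this
          omega
      choose s hs using hex
      have hsi : Function.Injective s := fun a a' haa' => by
        have := @hiw (Fin.castAdd l a) (Fin.castAdd l a') (by simp [← hs, haa'])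
        simpa using this
      refine Finset.mem_image.2 ⟨Equiv.ofBijective s (Finite.injective_iff_bijective.1 hsi),
        Finset.mem_univ _, ?_⟩
      funext a
      exact hs a
    rw [this, mul_zero]

/-- The complement of a list of indices. -/
def complL (w : List (Fin 7)) : List (Fin 7) := (List.finRange 7).filter (· ∉ w)

theorem evalL_stdStar (h : k + l = 7) (β : Cov k) {w : List (Fin 7)} (hw : w.length = l)
    (hn : w.Nodup) : evalL (stdStar h β) w = sgnL (complL w ++ w) * evalL β (complL w) := by
  have hnd : (complL w ++ w).Nodup :=
    List.Nodup.append ((List.nodup_finRange 7).filter _) hn (by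
      intro x hx hx'
      simp [complL] at hx
      exact hx hx')
  have hlen : (complL w ++ w).length = 7 := by
    have hperm : (complL w ++ w).Perm (List.finRange 7) := by
      rw [List.perm_ext_iff_of_nodup hnd (List.nodup_finRange 7)]
      intro x
      simp [complL, em']
    simpa using hperm.length_eq
  have hc : (complL w).length = k := by
    rw [List.length_append] at hlen; omega
  have happ : Fin.append (fun a : Fin k => (complL w).getD a 0) (fun b : Fin l => w.getD b 0) =
      fun j : Fin (k + l) => (complL w ++ w).getD j 0 := by
    funext j
    refine Fin.addCases (fun a => ?_) (fun b => ?_) j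
    · simp only [Fin.append_left, Fin.val_castAdd]
      rw [List.getD_append _ _ _ _ (by omega)]
    · simp only [Fin.append_right, Fin.val_natAdd]
      rw [List.getD_append_right _ _ _ _ (by omega), hc, Nat.add_sub_cancel_left]
  have := stdStar_stdVec h β (fun a => (complL w).getD a 0) (fun b => w.getD b 0) (by
    rw [happ]
    intro x y hxy
    have hx : (x : ℕ) < (complL w ++ w).length := by omega
    have hy : (y : ℕ) < (complL w ++ w).length := by omega
    simp only [List.getD_eq_getElem _ _ hx, List.getD_eq_getElem _ _ hy] at hxy
    exact Fin.ext ((hnd.getElem_inj_iff).1 hxy))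
  rw [evalL, this, happ]
  congr 1
  exact rep_stdVol _ hlen

end G2
end

noncomputable section

namespace G2

variable {k l m : ℕ}

/-! ### Components of the model form and of its dual -/

/-- The components of `e^i ∧ e^j ∧ e^k`. -/
def coord3L (i j k : Fin 7) : List (Fin 7) → ℤ :=
  wedgeL 2 1 (wedgeL 1 1 (coordL i) (coordL j)) (coordL k)

/-- The components of the model form. -/
def modelL (is : List (Fin 7)) : ℤ :=
  coord3L 0 1 6 is + coord3L 2 3 6 is + coord3L 4 5 6 is + coord3L 0 2 4 is
    - coord3L 0 3 5 is - coord3L 1 2 5 is - coord3L 1 3 4 is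

/-- The components of the dual of the model form. -/
def dualL (w : List (Fin 7)) : ℤ :=
  if w.Nodup then sgnL (complL w ++ w) * modelL (complL w) else 0

/-! ### Component identities of the model form, settled by finite evaluation -/

theorem wedgeL_contract_modelL : ∀ i j : Fin 7, ∀ w ∈ (List.finRange 7).sublistsLen 7,
    wedgeL 4 3 (wedgeL 2 2 (fun js => modelL (i :: js)) (fun js => modelL (j :: js))) modelL w =
      if i = j then 6 * sgnL w else 0 := by
  decide +kernel

theorem sum_wedgeL_contract_modelL : ∀ w ∈ (List.finRange 7).sublistsLen 4,
    ((List.finRange 7).map fun i => wedgeL 2 2 (fun js => modelL (i :: js))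
      (fun js => modelL (i :: js)) w).sum = 6 * dualL w := by
  decide +kernel

theorem wedgeL_coordL_dualL : ∀ i : Fin 7, ∀ w ∈ (List.finRange 7).sublistsLen 5,
    wedgeL 1 4 (coordL i) dualL w = sgnL (complL w ++ w) * modelL (i :: complL w) := by
  decide +kernel

theorem wedgeL_contract_modelL_modelL : ∀ i : Fin 7, ∀ w ∈ (List.finRange 7).sublistsLen 5,
    wedgeL 2 3 (fun js => modelL (i :: js)) modelL w = 2 * wedgeL 1 4 (coordL i) dualL w := by
  decide +kernel

/-- The component form of ι_iψ ∧ ι_jψ = 2 ι_{e_i×e_j} vol. -/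
theorem wedgeL_contract_dualL : ∀ i j : Fin 7, ∀ w ∈ (List.finRange 7).sublistsLen 6,
    wedgeL 3 3 (fun js => dualL (i :: js)) (fun js => dualL (j :: js)) w =
      2 * ((List.finRange 7).map fun k => modelL [i, j, k] * sgnL (k :: w)).sum := by
  decide +kernel

theorem sum_modelL_mul_modelL : ∀ i j : Fin 7,
    ((List.finRange 7).map fun k => ((List.finRange 7).map fun m =>
      modelL [i, k, m] * modelL [j, k, m]).sum).sum = if i = j then 6 else 0 := by
  decide +kernel

theorem complL_complL : ∀ w ∈ (List.finRange 7).sublists, complL (complL w) = w := by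
  decide +kernel

/-- Exchanging blocks of lengths k and 7 - k has sign (-1)^(k(7-k)) = 1; this is why ⋆⋆ = 1 in every
degree. -/
theorem sgnL_mul_sgnL_swap : ∀ w ∈ (List.finRange 7).sublists,
    sgnL (complL w ++ w) * sgnL (w ++ complL w) = 1 := by
  decide +kernel

end G2
end

noncomputable section

namespace G2

variable {k l m : ℕ}

/-! ### Linear algebra of the model form -/

theorem rep_modelForm : Rep modelForm modelL := by
  have h : ∀ i j k, Rep (coord3 i j k) (coord3L i j k) := fun i j k =>
    ((rep_coord i).wedge (rep_coord j) _).wedge (rep_coord k) _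
  exact ((((((h 0 1 6).add (h 2 3 6)).add (h 4 5 6)).add (h 0 2 4)).sub (h 0 3 5)).sub
    (h 1 2 5)).sub (h 1 3 4)

theorem length_of_mem_sublistsLen {w : List (Fin 7)}
    (hw : w ∈ (List.finRange 7).sublistsLen k) : w.length = k := (List.mem_sublistsLen.1 hw).2

theorem nodup_of_mem_sublistsLen {w : List (Fin 7)}
    (hw : w ∈ (List.finRange 7).sublistsLen k) : w.Nodup :=
  (List.nodup_finRange 7).sublist (List.mem_sublistsLen.1 hw).1

theorem mem_sublists_of_mem_sublistsLen {w : List (Fin 7)}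
    (hw : w ∈ (List.finRange 7).sublistsLen k) : w ∈ (List.finRange 7).sublists :=
  List.mem_sublists.2 (List.mem_sublistsLen.1 hw).1

theorem length_complL {w : List (Fin 7)} (hw : w.Nodup) :
    (complL w).length + w.length = 7 := by
  have hnd : (complL w ++ w).Nodup :=
    List.Nodup.append ((List.nodup_finRange 7).filter _) hw (by
      intro x hx hx'
      simp [complL] at hx
      exact hx hx')
  have hperm : (complL w ++ w).Perm (List.finRange 7) := by
    rw [List.perm_ext_iff_of_nodup hnd (List.nodup_finRange 7)]
    intro x
    simp [complL, em']
  simpa using hperm.length_eq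

theorem nodup_complL (w : List (Fin 7)) : (complL w).Nodup := (List.nodup_finRange 7).filter _

/-- The standard Hodge star is an involution. -/
theorem stdStar_stdStar (h : k + l = 7) (h' : l + k = 7) (β : Cov k) :
    stdStar h' (stdStar h β) = β := by
  apply cov_ext
  intro w hw
  have hn := nodup_of_mem_sublistsLen hw
  have hlen := length_of_mem_sublistsLen hw
  have hc := length_complL hn
  rw [evalL_stdStar h' _ hlen hn, evalL_stdStar h β (by omega) (nodup_complL w),
    complL_complL w (mem_sublists_of_mem_sublistsLen hw), ← mul_assoc, ← Int.cast_mul,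
    sgnL_mul_sgnL_swap w (mem_sublists_of_mem_sublistsLen hw), Int.cast_one, one_mul]

/-- The standard Hodge star as a linear map. -/
def stdStarₗ (h : k + l = 7) : Cov k →ₗ[ℝ] Cov l where
  toFun := stdStar h
  map_add' α β := by
    simp only [stdStar, ContinuousAlternatingMap.add_apply, add_smul, Finset.sum_add_distrib,
      smul_add]
  map_smul' c α := by
    simp only [stdStar, ContinuousAlternatingMap.smul_apply, smul_eq_mul, mul_smul,
      RingHom.id_apply, smul_comm _ c, ← Finset.smul_sum]

@[simp] theorem stdStarₗ_apply (h : k + l = 7) (β : Cov k) : stdStarₗ h β = stdStar h β := rfl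

/-- The dual of the model form. -/
def modelDual : Cov 4 := stdStar (k := 3) (l := 4) rfl modelForm

theorem rep_modelDual : Rep modelDual dualL := by
  intro w hw
  rw [dualL]
  split_ifs with hn
  · have hc := length_complL hn
    rw [modelDual, evalL_stdStar _ _ hw hn, rep_modelForm _ (by omega), Int.cast_mul]
  · rw [Int.cast_zero]
    refine cov_eq_zero_of_not_injective _ fun hinj => hn ?_
    rw [List.nodup_iff_injective_get]
    intro x y hxy
    have := @hinj (Fin.cast hw x) (Fin.cast hw y) (by simpa using congrArg stdVec hxy)
    simpa using this

/-- The contraction of a `3`-form as a linear map. -/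
def contractₗ (φ : Cov 3) : E7 →ₗ[ℝ] Cov 2 := φ.curryLeft.toLinearMap

@[simp] theorem contractₗ_apply (φ : Cov 3) (X : E7) : contractₗ φ X = contract X φ := rfl

/-- The bilinear map `(X, Y) ↦ ι_X φ ∧ ι_Y φ ∧ γ`. -/
def contractWedge (φ γ : Cov 3) : E7 →ₗ[ℝ] E7 →ₗ[ℝ] Cov 7 :=
  ((wedgeₗ (k := 2) (l := 2) (m := 4) rfl).compl₁₂ (contractₗ φ) (contractₗ φ)).compr₂
    ((wedgeₗ (k := 4) (l := 3) (m := 7) rfl).flip γ)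

theorem contractWedge_apply (φ γ : Cov 3) (X Y : E7) : contractWedge φ γ X Y =
    wedge (k := 4) (l := 3) rfl
      (wedge (k := 2) (l := 2) rfl (contract X φ) (contract Y φ)) γ := rfl

theorem inner_stdVec (i j : Fin 7) : inner ℝ (stdVec i) (stdVec j) = if i = j then (1 : ℝ) else 0 := by
  rw [stdVec, stdVec, EuclideanSpace.inner_single_left]
  simp

theorem inner_stdVec_left (i : Fin 7) (v : E7) : inner ℝ (stdVec i) v = v i := by
  rw [stdVec, EuclideanSpace.inner_single_left]
  simp

/-- Both sides are bilinear, so the frame suffices. It identifies the metric and volume of the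
model, and shows that ι_Xφ = 0 forces X = 0. -/
theorem model_contractWedge (X Y : E7) :
    wedge (k := 4) (l := 3) rfl
      (wedge (k := 2) (l := 2) rfl (contract X modelForm) (contract Y modelForm)) modelForm =
    (6 * inner ℝ X Y) • stdVol := by
  have : contractWedge modelForm modelForm =
      ((6 : ℝ) • innerₗ E7).compr₂ (LinearMap.toSpanSingleton ℝ (Cov 7) stdVol) := by
    refine stdBasis.ext fun i => stdBasis.ext fun j => cov_ext fun w hw => ?_
    have hlen := length_of_mem_sublistsLen hw
    simp only [stdBasis_apply, contractWedge_apply]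
    rw [(((rep_modelForm.contract i).wedge (rep_modelForm.contract j) _).wedge
      rep_modelForm _) w hlen, wedgeL_contract_modelL i j w hw]
    simp only [LinearMap.compr₂_apply, LinearMap.smul_apply, innerₗ_apply_apply, inner_stdVec,
      LinearMap.toSpanSingleton_apply, evalL_smul, rep_stdVol w hlen]
    split_ifs <;> simp
  simpa [contractWedge_apply] using congrArg (fun f => f X Y) this

theorem stdVol_sq (v : Fin 7 → E7) :
    stdVol v ^ 2 = (Matrix.of fun i j => inner ℝ (v i) (v j)).det := by
  rw [stdVol_apply, sq]
  conv_lhs => arg 2; rw [← Matrix.det_transpose]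
  rw [← Matrix.det_mul]
  congr 1
  ext i j
  simp [Matrix.mul_apply, PiLp.inner_apply, mul_comm]

theorem isMetricVolume_modelForm : IsMetricVolume modelForm (innerₗ E7) stdVol where
  symm X Y := real_inner_comm Y X
  pos X hX := real_inner_self_pos.2 hX
  volume := stdVol_sq
  eq X Y := by
    rw [model_contractWedge, smul_smul]
    congr 1
    rw [innerₗ_apply_apply]
    ring

/-- Turns the trace of j_φ(γ) into a multiple of ⋆(ψ ∧ γ). -/
theorem sum_contract_modelForm :
    ∑ i, wedge (k := 2) (l := 2) (m := 4) rfl (contract (stdVec i) modelForm)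
      (contract (stdVec i) modelForm) = (6 : ℝ) • modelDual := by
  refine cov_ext fun w hw => ?_
  have hlen := length_of_mem_sublistsLen hw
  rw [evalL_sum, evalL_smul, rep_modelDual w hlen]
  have := sum_wedgeL_contract_modelL w hw
  simp only [((rep_modelForm.contract _).wedge (rep_modelForm.contract _) _) w hlen]
  rw [← Fin.sum_univ_def] at this
  exact_mod_cast congrArg (Int.cast (R := ℝ)) this

theorem cov_one_eq_sum (α : Cov 1) : α = ∑ i, α (fun _ => stdVec i) • coord i := by
  refine ContinuousAlternatingMap.ext fun v => ?_
  have h : ∀ x : E7, α (fun _ => x) = ∑ i, x i * α (fun _ => stdVec i) := by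
    intro x
    set f := (ContinuousAlternatingMap.ofSubsingleton ℝ E7 ℝ (0 : Fin 1)).symm α with hf
    have h1 : ∀ x : E7, α (fun _ => x) = f x := fun x => rfl
    simp only [h1]
    conv_lhs => rw [← sum_smul_stdVec x]
    simp only [map_sum, map_smul, smul_eq_mul]
  have hv : v = fun _ => v 0 := funext fun a => by rw [Subsingleton.elim a 0]
  rw [hv, h]
  simp [coord_apply, mul_comm]

/-- By linearity it is enough to take coordinate covectors. This places α ∧ ψ in ⋆Λ²₇, where Λ²₇
consists of the contractions of φ. -/
theorem wedge_modelDual {p : 2 + 5 = 7} {r : 1 + 4 = 5} (α : Cov 1) : wedge r α modelDual =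
    stdStar p (contract (∑ i, α (fun _ => stdVec i) • stdVec i) modelForm) := by
  have key : ∀ i, wedge r (coord i) modelDual =
      stdStar p (contract (stdVec i) modelForm) := by
    intro i
    refine cov_ext fun w hw => ?_
    have hlen := length_of_mem_sublistsLen hw
    have hn := nodup_of_mem_sublistsLen hw
    have hc := length_complL hn
    rw [((rep_coord i).wedge rep_modelDual _) w hlen, wedgeL_coordL_dualL i w hw,
      evalL_stdStar _ _ hlen hn, (rep_modelForm.contract i) _ (by omega), Int.cast_mul]
  conv_lhs => rw [cov_one_eq_sum α]
  rw [← wedgeₗ_apply, ← contractₗ_apply, ← stdStarₗ_apply]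
  simp [map_sum, LinearMap.sum_apply, key]

/-- The eigenvalue of β ↦ ⋆(β ∧ φ) is 2 on Λ²₇, against -1 on Λ²₁₄. -/
theorem wedge_contract_modelForm {q : 2 + 3 = 5} {r : 1 + 4 = 5} (α : Cov 1) : wedge q
    (contract (∑ i, α (fun _ => stdVec i) • stdVec i) modelForm) modelForm =
    (2 : ℝ) • wedge r α modelDual := by
  have key : ∀ i, wedge q (contract (stdVec i) modelForm) modelForm =
      (2 : ℝ) • wedge r (coord i) modelDual := by
    intro i
    refine cov_ext fun w hw => ?_
    have hlen := length_of_mem_sublistsLen hw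
    rw [((rep_modelForm.contract i).wedge rep_modelForm _) w hlen, evalL_smul,
      ((rep_coord i).wedge rep_modelDual _) w hlen, wedgeL_contract_modelL_modelL i w hw]
    push_cast; ring
  conv_rhs => rw [cov_one_eq_sum α]
  rw [← wedgeₗ_apply, ← wedgeₗ_apply, ← contractₗ_apply]
  simp [map_sum, LinearMap.sum_apply, key, Finset.smul_sum, smul_comm _ (2 : ℝ)]

/-- A `1`-form `α` vanishes if `4 α ∧ ψ = ⋆τ` for a `2`-form `τ` with `τ ∧ φ = -⋆τ`. -/
theorem eq_zero_of_wedge_modelDual {p p' : 2 + 5 = 7} {q : 2 + 3 = 5} {r : 1 + 4 = 5} (α : Cov 1)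
    (τ : Cov 2) (h : stdStar p τ = (4 : ℝ) • wedge r α modelDual)
    (hτ : wedge q τ modelForm = -stdStar p' τ) : α = 0 := by
  have hp : stdStar p' τ = stdStar p τ := rfl
  rw [hp] at hτ
  obtain ⟨a, ha⟩ : ∃ a : E7, a = ∑ i, α (fun _ => stdVec i) • stdVec i := ⟨_, rfl⟩
  have hw := wedge_modelDual (p := p) (r := r) α
  have hc := wedge_contract_modelForm (q := q) (r := r) α
  rw [← ha] at hw hc
  have h1 : τ = (4 : ℝ) • contract a modelForm := by
    rw [← stdStar_stdStar p rfl τ, h, hw, ← stdStarₗ_apply,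
      map_smul, stdStarₗ_apply, stdStar_stdStar]
  -- With τ = 4 ι_aφ, the condition τ ∧ φ = -⋆τ reads 8 α ∧ ψ = -4 α ∧ ψ.
  have h2 : (12 : ℝ) • wedge r α modelDual = 0 := by
    rw [h, h1, wedge_smul_left, hc] at hτ
    rw [smul_smul, ← sub_eq_zero, sub_neg_eq_add, ← add_smul] at hτ
    norm_num at hτ ⊢
    exact hτ
  have h3 : wedge r α modelDual = 0 :=
    (smul_eq_zero.1 h2).resolve_left (by norm_num)
  have h4 : contract a modelForm = 0 := by
    rw [← stdStar_stdStar p rfl (contract a modelForm), ← hw, h3,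
      ← stdStarₗ_apply, map_zero]
  have hz : wedge (k := 4) (l := 3) (m := 7) rfl
      (wedge (k := 2) (l := 2) rfl (0 : Cov 2) (0 : Cov 2)) modelForm = 0 := by
    rw [← wedgeₗ_apply, ← wedgeₗ_apply, map_zero, map_zero, LinearMap.zero_apply]
  have h5 : (6 * inner ℝ a a) • stdVol = 0 := by
    rw [← model_contractWedge a a, h4]
    exact hz
  have h6 : (6 * inner ℝ a a) * stdVol stdVec = 0 := DFunLike.congr_fun h5 stdVec
  rw [stdVol_stdVec_self] at h6
  have h6 : a = 0 := by
    rw [← inner_self_eq_zero (𝕜 := ℝ)]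
    linarith
  rw [cov_one_eq_sum α]
  refine Finset.sum_eq_zero fun i _ => ?_
  have : a i = 0 := by rw [h6]; rfl
  have h7 : α (fun _ => stdVec i) = 0 := by
    rw [← this, ha]
    simp [stdVec_apply]
  rw [h7, zero_smul]

end G2
end

noncomputable section

namespace G2

variable {k l m : ℕ}

/-! ### The cross product and the stabilizer of the dual form -/

/-- The coefficients of the cross product. -/
theorem modelForm_stdVec (u v w : E7) :
    modelForm ![u, v, w] = ∑ k, modelForm ![u, v, stdVec k] * w k := by
  set f := (ContinuousAlternatingMap.ofSubsingleton ℝ E7 ℝ (0 : Fin 1)).symm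
    ((modelForm.curryLeft u).curryLeft v) with hf
  have h1 : ∀ w : E7, modelForm ![u, v, w] = f w := fun w => by
    rw [hf]
    change _ = modelForm (Matrix.vecCons u (Matrix.vecCons v fun _ => w))
    congr 1
    funext a
    fin_cases a <;> rfl
  simp only [h1]
  conv_lhs => rw [← sum_smul_stdVec w]
  simp only [map_sum, map_smul, smul_eq_mul, mul_comm]

/-- The cross product of the model form. -/
def cross : E7 →ₗ[ℝ] E7 →ₗ[ℝ] E7 :=
  LinearMap.mk₂ ℝ (fun u v => ∑ k, modelForm ![u, v, stdVec k] • stdVec k)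
    (fun u u' v => by
      simp only [← Finset.sum_add_distrib, ← add_smul]
      exact Finset.sum_congr rfl fun k _ => by
        congr 1
        exact modelForm.vecCons_add ![v, stdVec k] u u')
    (fun c u v => by
      simp only [Finset.smul_sum, smul_smul]
      exact Finset.sum_congr rfl fun k _ => by
        congr 1
        exact modelForm.vecCons_smul ![v, stdVec k] c u)
    (fun u v v' => by
      simp only [← Finset.sum_add_distrib, ← add_smul]
      exact Finset.sum_congr rfl fun k _ => by
        congr 1
        exact (modelForm.curryLeft u).vecCons_add ![stdVec k] v v')
    (fun c u v => by
      simp only [Finset.smul_sum, smul_smul]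
      exact Finset.sum_congr rfl fun k _ => by
        congr 1
        exact (modelForm.curryLeft u).vecCons_smul ![stdVec k] c v)

theorem cross_apply (u v : E7) : cross u v = ∑ k, modelForm ![u, v, stdVec k] • stdVec k := rfl

theorem inner_cross (u v w : E7) : inner ℝ (cross u v) w = modelForm ![u, v, w] := by
  rw [cross_apply, sum_inner, modelForm_stdVec]
  simp [inner_smul_left, inner_stdVec_left]

theorem modelForm_stdVec_stdVec (i j k : Fin 7) :
    modelForm ![stdVec i, stdVec j, stdVec k] = modelL [i, j, k] := by
  rw [← rep_modelForm [i, j, k] rfl, evalL]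
  congr 1
  funext a
  fin_cases a <;> rfl

theorem modelForm_swap (u v w : E7) : modelForm ![u, v, w] = -modelForm ![u, w, v] := by
  have := cov_perm modelForm ![u, v, w] (Equiv.swap 1 2)
  have hs : Equiv.Perm.sign (Equiv.swap (1 : Fin 3) 2) = -1 := by decide
  rw [hs] at this
  rw [show ![u, w, v] = fun a => ![u, v, w] (Equiv.swap 1 2 a) from by
    funext a; fin_cases a <;> rfl, this]
  simp

/-- By skewness of φ, ⟨e_k, u×(v×e_k)⟩ = -⟨u×e_k, v×e_k⟩, and φ_{ikm}φ_{jkm} = 6δ_{ij} sums these.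
The metric can thus be read off from the cross product alone. -/
theorem trace_cross_cross (u v : E7) :
    LinearMap.trace ℝ E7 (cross u ∘ₗ cross v) = -6 * inner ℝ u v := by
  have h : ∑ k, (innerₗ E7).compl₁₂ (cross.flip (stdVec k)) (cross.flip (stdVec k)) =
      (6 : ℝ) • innerₗ E7 := by
    refine stdBasis.ext fun i => stdBasis.ext fun j => ?_
    have key := congrArg (Int.cast (R := ℝ)) (sum_modelL_mul_modelL i j)
    simp only [← Fin.sum_univ_def] at key
    simp only [LinearMap.sum_apply, LinearMap.compl₁₂_apply, LinearMap.flip_apply,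
      LinearMap.smul_apply, innerₗ_apply_apply, stdBasis_apply, inner_stdVec]
    have hterm : ∀ k, inner ℝ (cross (stdVec i) (stdVec k)) (cross (stdVec j) (stdVec k)) =
        ∑ m, (modelL [i, k, m] : ℝ) * modelL [j, k, m] := by
      intro k
      rw [cross_apply, sum_inner]
      refine Finset.sum_congr rfl fun m _ => ?_
      rw [inner_smul_left, real_inner_comm, inner_cross, modelForm_stdVec_stdVec,
        modelForm_stdVec_stdVec]
      rfl
    simp only [hterm]
    refine Eq.trans ?_ (key.trans ?_)
    · push_cast; rfl
    · split_ifs <;> simp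
  have hk : ∀ k, inner ℝ (stdVec k) ((cross u ∘ₗ cross v) (stdVec k)) =
      -inner ℝ (cross u (stdVec k)) (cross v (stdVec k)) := fun k => by
    rw [LinearMap.comp_apply, real_inner_comm, inner_cross, inner_cross, modelForm_swap]
  have h1 := congrArg (fun f => f u v) h
  simp only [LinearMap.sum_apply, LinearMap.compl₁₂_apply, LinearMap.flip_apply,
    LinearMap.smul_apply, innerₗ_apply_apply, smul_eq_mul] at h1
  rw [LinearMap.trace_eq_sum_inner _ (EuclideanSpace.basisFun (Fin 7) ℝ)]
  simp only [EuclideanSpace.basisFun_apply]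
  refine (Finset.sum_congr rfl fun k _ => hk k).trans ?_
  rw [Finset.sum_neg_distrib, h1]
  ring

/-- Expresses the cross product through ψ and the volume form, without using φ. -/
theorem modelDual_contract_wedge (u v : E7) :
    wedge (k := 3) (l := 3) (m := 6) rfl (modelDual.curryLeft u) (modelDual.curryLeft v) =
      (2 : ℝ) • stdVol.curryLeft (cross u v) := by
  have : (wedgeₗ (k := 3) (l := 3) (m := 6) rfl).compl₁₂ modelDual.curryLeft.toLinearMap
      modelDual.curryLeft.toLinearMap =
      cross.compr₂ ((2 : ℝ) • stdVol.curryLeft.toLinearMap) := by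
    refine stdBasis.ext fun i => stdBasis.ext fun j => cov_ext fun w hw => ?_
    have hlen := length_of_mem_sublistsLen hw
    simp only [stdBasis_apply, LinearMap.compl₁₂_apply, wedgeₗ_apply, LinearMap.compr₂_apply,
      LinearMap.smul_apply, ContinuousLinearMap.coe_coe, cross_apply, map_sum, map_smul,
      evalL_smul, evalL_sum, evalL_curryLeft, modelForm_stdVec_stdVec]
    rw [((rep_modelDual.curryLeft i).wedge (rep_modelDual.curryLeft j) _) w hlen,
      wedgeL_contract_dualL i j w hw, ← Fin.sum_univ_def]
    push_cast
    rw [Finset.mul_sum]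
    refine Finset.sum_congr rfl fun k _ => ?_
    rw [rep_stdVol _ (by simp [hlen])]
    ring
  exact congrArg (fun f => f u v) this

/-- On the frame with e_i left out, ι_x vol takes the value ± x_i. -/
theorem eq_of_curryLeft_stdVol {x y : E7} (h : stdVol.curryLeft x = stdVol.curryLeft y) :
    x = y := by
  have key : ∀ (x : E7) (i : Fin 7),
      stdVol.curryLeft x (fun j => stdVec (i.succAbove j)) = (-1) ^ (i : ℕ) * x i := by
    intro x i
    have h1 := stdVol.map_insertNth i x (fun j => stdVec (i.succAbove j))
    have h2 : i.insertNth x (fun j => stdVec (i.succAbove j)) = Function.update stdVec i x := by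
      rw [Fin.insertNth_eq_iff]
      refine ⟨by simp, ?_⟩
      funext j
      simp [Fin.removeNth]
    have h3 : stdVol (Function.update stdVec i x) = x i := by
      conv_lhs => rw [← sum_smul_stdVec x]
      rw [← ContinuousAlternatingMap.coe_toAlternatingMap, AlternatingMap.map_update_sum]
      simp only [AlternatingMap.map_update_smul]
      rw [Finset.sum_eq_single i]
      · rw [Function.update_eq_self]
        change x i * stdVol stdVec = _
        rw [stdVol_stdVec_self, mul_one]
      · intro j _ hj
        rw [AlternatingMap.map_eq_zero_of_eq _ _ (i := i) (j := j) (by simp [hj]) hj.symm,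
          smul_zero]
      · simp
    rw [h2, h3] at h1
    change stdVol (Matrix.vecCons x _) = _
    have h4 : ((-1 : ℝ) ^ (i : ℕ)) * (-1) ^ (i : ℕ) = 1 := by
      rw [← mul_pow]; simp
    rw [h1, zsmul_eq_mul]
    push_cast
    rw [← mul_assoc, h4, one_mul]
  ext i
  have := key x i
  rw [h, key y i] at this
  exact (mul_left_cancel₀ (by positivity) this).symm

theorem pull_curryLeft (L : E7 ≃L[ℝ] E7) {α β : Cov (k + 1)}
    (h : pull (L : E7 →L[ℝ] E7) α = β) (x : E7) :
    pull (L : E7 →L[ℝ] E7) (α.curryLeft (L x)) = β.curryLeft x := by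
  subst h
  ext v
  change α (Matrix.vecCons _ _) = α _
  congr 1
  funext a
  refine Fin.cases rfl (fun b => rfl) a

theorem pull_modelForm_eq (L : E7 ≃L[ℝ] E7) {c : ℝ} (hc : 0 < c)
    (hψ : pull (L : E7 →L[ℝ] E7) modelDual = modelDual)
    (hν : pull (L : E7 →L[ℝ] E7) stdVol = c • stdVol) :
    pull (L : E7 →L[ℝ] E7) modelForm = modelForm := by
  -- Pull back ι_{Lu}ψ ∧ ι_{Lv}ψ = 2 ι_{Lu×Lv} vol along L: ψ is invariant, and the volume form
  -- produces the factor c.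
  have hcross : ∀ u v, c • cross (L u) (L v) = L (cross u v) := by
    intro u v
    have h1 := congrArg (pull (L : E7 →L[ℝ] E7)) (modelDual_contract_wedge (L u) (L v))
    obtain ⟨z, hz⟩ := L.surjective (cross (L u) (L v))
    have e : ∀ u, pull (L : E7 →L[ℝ] E7) (modelDual.curryLeft (L u)) = modelDual.curryLeft u :=
      fun u => pull_curryLeft (k := 3) L hψ u
    have e3 : pull (L : E7 →L[ℝ] E7) (stdVol.curryLeft (L z)) = stdVol.curryLeft (c • z) := by
      rw [pull_curryLeft (k := 6) L hν z, map_smul]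
      ext v; rfl
    have h2 : pull (L : E7 →L[ℝ] E7) ((2 : ℝ) • stdVol.curryLeft (cross (L u) (L v))) =
        (2 : ℝ) • pull (L : E7 →L[ℝ] E7) (stdVol.curryLeft (L z)) := by rw [hz]; rfl
    rw [h2, pull_wedge, e, e, e3, modelDual_contract_wedge] at h1
    have h4 := eq_of_curryLeft_stdVol (smul_right_injective _ (two_ne_zero' ℝ) h1)
    rw [h4, map_smul, hz]
  -- Up to c², the operator u×(v×·) is conjugate to Lu×(Lv×·), so their traces are proportional.
  have hinner : ∀ u v, inner ℝ u v = c ^ 2 * inner ℝ (L u) (L v) := by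
    intro u v
    have h1 := trace_cross_cross u v
    have h2 := trace_cross_cross (L u) (L v)
    have h3 : cross u ∘ₗ cross v =
        (c ^ 2) • (L.symm.toLinearEquiv.conj (cross (L u) ∘ₗ cross (L v))) := by
      ext1 w
      apply L.injective
      simp only [LinearMap.comp_apply, LinearMap.smul_apply, LinearEquiv.conj_apply]
      rw [← hcross, ← hcross]
      simp [smul_smul, sq]
    rw [h3, map_smul, LinearMap.trace_conj', h2, smul_eq_mul] at h1
    linarith
  -- The Gram determinant of the frame L e_i equals both c² and (c⁻²)⁷, so c¹⁶ = 1; positivity of c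
  -- excludes -1.
  have hc1 : c = 1 := by
    have h1 : stdVol (fun i => L (stdVec i)) = c := by
      have := DFunLike.congr_fun hν stdVec
      refine this.trans ?_
      change c * stdVol stdVec = c
      rw [stdVol_stdVec_self, mul_one]
    have h2 := stdVol_sq (fun i => L (stdVec i))
    have h3 : (Matrix.of fun i j => inner ℝ (L (stdVec i)) (L (stdVec j))) =
        ((c ^ 2)⁻¹) • (1 : Matrix (Fin 7) (Fin 7) ℝ) := by
      ext i j
      have := hinner (stdVec i) (stdVec j)
      rw [inner_stdVec] at this
      rw [Matrix.of_apply, Matrix.smul_apply, Matrix.one_apply, this, smul_eq_mul]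
      field_simp
    rw [h1, h3, Matrix.det_smul, Matrix.det_one, Fintype.card_fin, mul_one] at h2
    have h4 : c ^ 16 = 1 := by
      field_simp at h2
      linear_combination h2
    exact (pow_eq_one_iff_of_nonneg hc.le (by norm_num)).1 h4
  ext v
  have hv : v = ![v 0, v 1, v 2] := by funext a; fin_cases a <;> rfl
  have h1 : pull (L : E7 →L[ℝ] E7) modelForm v = modelForm ![L (v 0), L (v 1), L (v 2)] := by
    rw [pull_apply]
    congr 1
    funext a
    fin_cases a <;> rfl
  rw [h1, ← inner_cross]
  conv_rhs => rw [hv, ← inner_cross, hinner, ← hcross]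
  simp [hc1]

end G2
end

noncomputable section

namespace G2

variable {k l m : ℕ}

/-! ### Graded commutativity -/

/-- Induction on the total degree: contract both sides with the first vector and compare by the
antiderivation rule. -/
theorem wedge_comm (h : k + l = m) (h' : l + k = m) (α : Cov k) (β : Cov l) :
    wedge h α β = (-1 : ℝ) ^ (k * l) • wedge h' β α := by
  induction m generalizing k l with
  | zero =>
    obtain rfl : k = 0 := by omega
    obtain rfl : l = 0 := by omega
    rw [wedge_zero_left, wedge_zero_right]
    simp
  | succ m ih =>
    rcases k with _ | k
    · obtain rfl : l = m + 1 := by omega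
      rw [wedge_zero_left, wedge_zero_right]
      simp
    rcases l with _ | l
    · obtain rfl : k = m := by omega
      rw [wedge_zero_left, wedge_zero_right]
      simp
    have key : ∀ x, (wedge h α β).curryLeft x =
        ((-1 : ℝ) ^ ((k + 1) * (l + 1)) • wedge h' β α).curryLeft x := by
      intro x
      have e : ((-1 : ℝ) ^ ((k + 1) * (l + 1)) • wedge h' β α).curryLeft x =
        (-1 : ℝ) ^ ((k + 1) * (l + 1)) • (wedge h' β α).curryLeft x := rfl
      rw [e, curryLeft_wedge h (by omega) (by omega), curryLeft_wedge h' (by omega) (by omega),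
        ih (by omega) (by omega) (α.curryLeft x) β, ih (by omega) (by omega) α (β.curryLeft x),
        smul_add, smul_smul, smul_smul, add_comm]
      congr 2
      · rw [show (k + 1) * (l + 1) = (k + 1) + (k + 1) * l by ring, pow_add _ (k + 1)]
      · rw [← pow_add, show (k + 1) * (l + 1) + (l + 1) = k * (l + 1) + 2 * (l + 1) by ring,
          pow_add, pow_mul _ 2]
        simp
    ext v
    have hv : v = Matrix.vecCons (v 0) (fun i => v i.succ) := (Fin.cons_self_tail v).symm
    rw [hv]
    exact DFunLike.congr_fun (key (v 0)) _

/-! ### Metric and volume form of a `G₂` form -/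

theorem pull_smul (L : E7 →L[ℝ] E7) (c : ℝ) (α : Cov k) : pull L (c • α) = c • pull L α := rfl

theorem pull_neg (L : E7 →L[ℝ] E7) (α : Cov k) : pull L (-α) = -pull L α := rfl

theorem pull_sum {ι : Type*} (L : E7 →L[ℝ] E7) (s : Finset ι) (α : ι → Cov k) :
    pull L (∑ i ∈ s, α i) = ∑ i ∈ s, pull L (α i) := by
  ext v
  simp [ContinuousAlternatingMap.sum_apply]

theorem pull_symm_pull (L : E7 ≃L[ℝ] E7) (α : Cov k) :
    pull (L.symm : E7 →L[ℝ] E7) (pull (L : E7 →L[ℝ] E7) α) = α := by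
  ext v
  change α (fun i => L (L.symm (v i))) = α v
  simp only [ContinuousLinearEquiv.apply_symm_apply]

theorem pull_pull_symm (L : E7 ≃L[ℝ] E7) (α : Cov k) :
    pull (L : E7 →L[ℝ] E7) (pull (L.symm : E7 →L[ℝ] E7) α) = α := pull_symm_pull L.symm α

theorem pull_trans (L L' : E7 ≃L[ℝ] E7) (α : Cov k) :
    pull ((L.trans L' : E7 ≃L[ℝ] E7) : E7 →L[ℝ] E7) α =
      pull (L : E7 →L[ℝ] E7) (pull (L' : E7 →L[ℝ] E7) α) := rfl

theorem pull_injective (L : E7 ≃L[ℝ] E7) :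
    Function.Injective (pull (L : E7 →L[ℝ] E7) : Cov k → Cov k) :=
  Function.LeftInverse.injective (pull_symm_pull L)

theorem eq_of_pull_eq {L : E7 ≃L[ℝ] E7} {α β : Cov k}
    (h : pull (L : E7 →L[ℝ] E7) α = pull (L : E7 →L[ℝ] E7) β) : α = β := pull_injective L h

theorem exists_pull_eq (L : E7 ≃L[ℝ] E7) (β : Cov k) :
    ∃ β' : Cov k, β = pull (L : E7 →L[ℝ] E7) β' := ⟨_, (pull_pull_symm L β).symm⟩

theorem pull_contract (L : E7 ≃L[ℝ] E7) (φ : Cov 3) (x : E7) :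
    contract x (pull (L : E7 →L[ℝ] E7) φ) = pull (L : E7 →L[ℝ] E7) (contract (L x) φ) :=
  (pull_curryLeft (k := 2) L rfl x).symm

theorem isMetricVolume_pull (L : E7 ≃L[ℝ] E7) :
    IsMetricVolume (pull (L : E7 →L[ℝ] E7) modelForm)
      ((innerₗ E7).compl₁₂ L.toLinearMap L.toLinearMap) (pull (L : E7 →L[ℝ] E7) stdVol) where
  symm X Y := real_inner_comm (L Y) (L X)
  pos X hX := real_inner_self_pos.2 fun h => hX (L.map_eq_zero_iff.1 h)
  volume v := stdVol_sq fun i => L (v i)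
  eq X Y := by
    have h := congrArg (pull (L : E7 →L[ℝ] E7)) (isMetricVolume_modelForm.eq (L X) (L Y))
    rw [pull_contract, pull_contract, ← pull_wedge, ← pull_wedge]
    rw [pull_smul, pull_smul] at h
    have e : (innerₗ E7).compl₁₂ L.toLinearMap L.toLinearMap X Y = innerₗ E7 (L X) (L Y) := rfl
    rw [e, h]

theorem eq_of_apply_frame (L : E7 ≃L[ℝ] E7) {α β : Cov 7}
    (h : α (fun i => L.symm (stdVec i)) = β (fun i => L.symm (stdVec i))) : α = β := by
  have h1 : pull (L.symm : E7 →L[ℝ] E7) α = pull (L.symm : E7 →L[ℝ] E7) β := by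
    refine cov_ext fun w hw => ?_
    have : w = List.finRange 7 := by
      have : (List.finRange 7).sublistsLen 7 = [List.finRange 7] := by decide
      rw [this] at hw
      simpa using hw
    rw [this]
    have e : (fun a : Fin 7 => stdVec ((List.finRange 7).getD a 0)) = stdVec := by
      funext a
      fin_cases a <;> rfl
    rw [evalL, evalL, e]
    exact h
  exact pull_injective L.symm h1

/-- The defining equation fixes g ⊗ ν, and the volume normalization fixes the remaining scale. This
makes the choice in `metricVolume` canonical on G₂ forms. -/
theorem IsMetricVolume.unique {L : E7 ≃L[ℝ] E7} {g : LinearMap.BilinForm ℝ E7} {ν : Cov 7}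
    (h : IsMetricVolume (pull (L : E7 →L[ℝ] E7) modelForm) g ν) :
    g = (innerₗ E7).compl₁₂ L.toLinearMap L.toLinearMap ∧ ν = pull (L : E7 →L[ℝ] E7) stdVol := by
  have h' := isMetricVolume_pull L
  set v : Fin 7 → E7 := fun i => L.symm (stdVec i) with hv
  have h1 : pull (L : E7 →L[ℝ] E7) stdVol v = 1 := by
    rw [pull_apply, ← stdVol_stdVec_self]
    congr 1
    funext i
    simp [hv]
  have h2 : ∀ X Y, g X Y * ν v = inner ℝ (L X) (L Y) := by
    intro X Y
    have := DFunLike.congr_fun ((h.eq X Y).trans (h'.eq X Y).symm) v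
    change g X Y * ν v = inner ℝ (L X) (L Y) * pull (L : E7 →L[ℝ] E7) stdVol v at this
    rw [this, h1, mul_one]
  have h3 : ∀ i j, g (v i) (v j) * ν v = if i = j then 1 else 0 := by
    intro i j
    rw [h2, ← inner_stdVec]
    simp [hv]
  have h0 : ν v ≠ 0 := by
    intro h0
    have := h3 0 0
    rw [h0] at this
    simp at this
  have h4 : (Matrix.of fun i j => g (v i) (v j)) = (ν v)⁻¹ • (1 : Matrix (Fin 7) (Fin 7) ℝ) := by
    ext i j
    rw [Matrix.of_apply, Matrix.smul_apply, Matrix.one_apply, smul_eq_mul, ← h3 i j]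
    field_simp
  have h5 := h.volume v
  rw [h4, Matrix.det_smul, Matrix.det_one, Fintype.card_fin, mul_one] at h5
  -- On this frame g has Gram matrix ν(v)⁻¹ times the identity, so ν(v)² = ν(v)⁻⁷. The odd exponent
  -- 9 also settles the sign.
  have h6 : ν v ^ 9 = 1 := by
    field_simp at h5
    linear_combination h5
  have h7 : ν v = 1 := by
    have : Odd 9 := by decide
    exact (this.strictMono_pow (R := ℝ)).injective (by simpa using h6)
  refine ⟨?_, eq_of_apply_frame L (h7.trans h1.symm)⟩
  refine LinearMap.ext fun X => LinearMap.ext fun Y => ?_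
  have := h2 X Y
  rw [h7, mul_one] at this
  exact this

theorem isMetricVolume_metricVolume (L : E7 ≃L[ℝ] E7) :
    IsMetricVolume (pull (L : E7 →L[ℝ] E7) modelForm)
      (metric (pull (L : E7 →L[ℝ] E7) modelForm)) (vol (pull (L : E7 →L[ℝ] E7) modelForm)) :=
  Classical.epsilon_spec (p := fun p : LinearMap.BilinForm ℝ E7 × Cov 7 =>
    IsMetricVolume (pull (L : E7 →L[ℝ] E7) modelForm) p.1 p.2) ⟨(_, _), isMetricVolume_pull L⟩

theorem metric_pull (L : E7 ≃L[ℝ] E7) (X Y : E7) :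
    metric (pull (L : E7 →L[ℝ] E7) modelForm) X Y = inner ℝ (L X) (L Y) := by
  rw [(isMetricVolume_metricVolume L).unique.1]
  rfl

theorem vol_pull (L : E7 ≃L[ℝ] E7) :
    vol (pull (L : E7 →L[ℝ] E7) modelForm) = pull (L : E7 →L[ℝ] E7) stdVol :=
  (isMetricVolume_metricVolume L).unique.2

/-- The coordinates of the frame that `L` maps to the standard one. -/
def frameMatrix (L : E7 ≃L[ℝ] E7) : Matrix (Fin 7) (Fin 7) ℝ :=
  Matrix.of fun a i => L.symm (stdVec a) i

theorem sum_frameMatrix (L : E7 ≃L[ℝ] E7) (a : Fin 7) :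
    ∑ i, frameMatrix L a i • stdVec i = L.symm (stdVec a) := sum_smul_stdVec _

/-- The rows of P = `frameMatrix L` are an orthonormal frame, so P G Pᵀ = 1 and G⁻¹ = Pᵀ P. -/
theorem invGram_pull (L : E7 ≃L[ℝ] E7) : invGram (pull (L : E7 →L[ℝ] E7) modelForm) =
    (frameMatrix L).transpose * frameMatrix L := by
  set P := frameMatrix L with hP
  set G : Matrix (Fin 7) (Fin 7) ℝ := Matrix.of fun i j => inner ℝ (L (stdVec i)) (L (stdVec j))
    with hG
  have h1 : P * (G * P.transpose) = 1 := by
    ext a c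
    have h2 : ∀ i, (G * P.transpose) i c = inner ℝ (L (stdVec i)) (stdVec c) := by
      intro i
      have : stdVec c = L (∑ j, P c j • stdVec j) := by rw [sum_frameMatrix]; simp
      conv_rhs => rw [this]
      rw [map_sum, inner_sum]
      simp [Matrix.mul_apply, hG, inner_smul_right, mul_comm]
    rw [Matrix.mul_apply, Matrix.one_apply, ← inner_stdVec]
    have : stdVec a = L (∑ j, P a j • stdVec j) := by rw [sum_frameMatrix]; simp
    conv_rhs => rw [this]
    rw [map_sum, sum_inner]
    simp [h2, inner_smul_left]
  have h3 : invGram (pull (L : E7 →L[ℝ] E7) modelForm) = G⁻¹ := by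
    rw [invGram, hG]
    congr 1
    ext i j
    exact metric_pull L _ _
  rw [h3]
  refine Matrix.inv_eq_right_inv ?_
  rw [← Matrix.mul_assoc]
  exact mul_eq_one_comm.1 h1

theorem dualVec_pull (L : E7 ≃L[ℝ] E7) (i : Fin 7) :
    dualVec (pull (L : E7 →L[ℝ] E7) modelForm) i =
      ∑ a, frameMatrix L a i • L.symm (stdVec a) := by
  rw [dualVec, invGram_pull]
  simp only [Matrix.mul_apply, Matrix.transpose_apply, Finset.sum_smul, ← sum_frameMatrix,
    Finset.smul_sum, smul_smul]
  exact Finset.sum_comm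

/-- The trace of a bilinear form, computed in an orthonormal frame. -/
theorem trace_pull (L : E7 ≃L[ℝ] E7) (B : LinearMap.BilinForm ℝ E7) :
    trace (pull (L : E7 →L[ℝ] E7) modelForm) (fun X Y => B X Y) =
      ∑ a, B (L.symm (stdVec a)) (L.symm (stdVec a)) := by
  rw [trace, invGram_pull]
  simp only [← sum_frameMatrix, map_sum, map_smul, LinearMap.sum_apply, LinearMap.smul_apply,
    Matrix.mul_apply, Matrix.transpose_apply, Finset.sum_mul, smul_eq_mul, Finset.mul_sum]
  rw [Finset.sum_congr rfl fun i _ => Finset.sum_comm, Finset.sum_comm]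
  refine Finset.sum_congr rfl fun a _ => ?_
  rw [Finset.sum_comm]
  exact Finset.sum_congr rfl fun i _ => Finset.sum_congr rfl fun j _ => by ring

/-- Shifts the change of frame from one factor to the other; this replaces the auxiliary basis and
its dual by a single orthonormal frame in the formula for ⋆. -/
theorem sum_multilinear_mul {ι : Type*} [Fintype ι] [DecidableEq ι]
    (B F : MultilinearMap ℝ (fun _ : Fin k => E7) ℝ) (P : Matrix ι ι ℝ) (x y : ι → E7) :
    ∑ i : Fin k → ι, B (fun s => x (i s)) * F (fun s => ∑ a, P a (i s) • y a) =
      ∑ a : Fin k → ι, B (fun s => ∑ i, P (a s) i • x i) * F (fun s => y (a s)) := by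
  simp only [MultilinearMap.map_sum, MultilinearMap.map_smul_univ, Finset.mul_sum, Finset.sum_mul,
    smul_eq_mul]
  rw [Finset.sum_comm]
  exact Finset.sum_congr rfl fun i _ => Finset.sum_congr rfl fun j _ => by ring

theorem exists_multilinear_append (h : k + l = m) (ν : Cov m) (w : Fin l → E7) :
    ∃ F : MultilinearMap ℝ (fun _ : Fin k => E7) ℝ,
      ∀ u, F u = ν fun i => Fin.append u w (Fin.cast h.symm i) := by
  subst h
  let f : MultilinearMap ℝ (fun _ : Fin k ⊕ Fin l => E7) ℝ :=
    ν.toMultilinearMap.domDomCongr finSumFinEquiv.symm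
  refine ⟨{ toFun := fun u => f.currySum u w
            map_update_add' := ?_
            map_update_smul' := ?_ }, fun u => ?_⟩
  · intro _ u i x y
    rw [MultilinearMap.map_update_add, _root_.add_apply]
  · intro _ u i c x
    rw [MultilinearMap.map_update_smul, _root_.smul_apply]
  · change ν _ = ν _
    congr 1
    funext j
    refine Fin.addCases (fun a => ?_) (fun a => ?_) j <;> simp

/-- The dual vectors are combinations of the orthonormal frame L⁻¹e_a. Moving their coefficients
onto the form leaves the standard star, pulled back. -/
theorem star_pull (L : E7 ≃L[ℝ] E7) (h : k + l = 7) (β : Cov k) :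
    star (pull (L : E7 →L[ℝ] E7) modelForm) h (pull (L : E7 →L[ℝ] E7) β) =
      pull (L : E7 →L[ℝ] E7) (stdStar h β) := by
  ext w
  obtain ⟨F, hF⟩ := exists_multilinear_append h (pull (L : E7 →L[ℝ] E7) stdVol) w
  have h1 : star (pull (L : E7 →L[ℝ] E7) modelForm) h (pull (L : E7 →L[ℝ] E7) β) w =
      ((k.factorial : ℝ)⁻¹) * ∑ i : Fin k → Fin 7,
        (pull (L : E7 →L[ℝ] E7) β).toMultilinearMap (fun s => stdVec (i s)) *
          F (fun s => ∑ a, frameMatrix L a (i s) • L.symm (stdVec a)) := by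
    rw [star, ContinuousAlternatingMap.smul_apply, ContinuousAlternatingMap.sum_apply, vol_pull]
    simp only [hF, ← dualVec_pull]
    rfl
  rw [h1, sum_multilinear_mul, pull_apply, stdStar_apply]
  congr 1
  refine Finset.sum_congr rfl fun a _ => ?_
  rw [hF]
  simp only [sum_frameMatrix]
  congr 1
  · change β _ = β _
    congr 1
    funext s
    simp
  · rw [pull_apply]
    congr 1
    funext j
    have : ∀ j', L (Fin.append (fun s => L.symm (stdVec (a s))) w j') =
        Fin.append (fun s => stdVec (a s)) (fun i => L (w i)) j' := by
      intro j'
      refine Fin.addCases (fun a => ?_) (fun a => ?_) j' <;> simp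
    exact this _

theorem dual_pull (L : E7 ≃L[ℝ] E7) : dual (pull (L : E7 →L[ℝ] E7) modelForm) =
    pull (L : E7 →L[ℝ] E7) modelDual := star_pull L _ _

/-! ### Consequences for `G₂` forms -/

/-- The Hodge star of a `3`-form as a linear map. -/
def starₗ (φ : Cov 3) (h : k + l = 7) : Cov k →ₗ[ℝ] Cov l where
  toFun := star φ h
  map_add' α β := by
    simp only [star, ContinuousAlternatingMap.add_apply, add_smul, Finset.sum_add_distrib,
      smul_add]
  map_smul' c α := by
    simp only [star, ContinuousAlternatingMap.smul_apply, smul_eq_mul, mul_smul,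
      RingHom.id_apply, smul_comm _ c, ← Finset.smul_sum]

@[simp] theorem starₗ_apply (φ : Cov 3) (h : k + l = 7) (β : Cov k) :
    starₗ φ h β = star φ h β := rfl

theorem star_star {φ : Cov 3} (hφ : IsG2 φ) (h : k + l = 7) (h' : l + k = 7) (β : Cov k) :
    star φ h' (star φ h β) = β := by
  obtain ⟨L, rfl⟩ := hφ
  obtain ⟨β, rfl⟩ := exists_pull_eq L β
  have := star_pull L h β
  refine (congrArg _ this).trans ((star_pull L h' _).trans ?_)
  rw [stdStar_stdStar]

theorem eq_zero_of_wedge_dual {p : 2 + 5 = 7} {r : 1 + 4 = 5} {φ : Cov 3} (hφ : IsG2 φ)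
    {α : Cov 1} {τ : Cov 2} (h : (4 : ℝ) • wedge r α (dual φ) = star φ p τ)
    (hτ : Mem14 φ τ) : α = 0 := by
  obtain ⟨L, hL⟩ := hφ
  change φ = pull (L : E7 →L[ℝ] E7) modelForm at hL
  subst hL
  obtain ⟨α, rfl⟩ := exists_pull_eq L α
  obtain ⟨τ, rfl⟩ := exists_pull_eq L τ
  rw [Mem14, star_pull, ← pull_wedge, ← pull_neg] at hτ
  rw [star_pull, dual_pull, ← pull_wedge, ← pull_smul] at h
  have : α = 0 := eq_zero_of_wedge_modelDual α τ (eq_of_pull_eq h.symm) (eq_of_pull_eq hτ)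
  rw [this]
  rfl

/-- The dual form and the orientation determine a `G₂` form. -/
theorem eq_of_dual_eq {φ φ' : Cov 3} (hφ : IsG2 φ) (hφ' : IsG2 φ') (hor : SameOrientation φ φ')
    (h : dual φ' = dual φ) : φ' = φ := by
  obtain ⟨L, hL⟩ := hφ
  obtain ⟨L', hL'⟩ := hφ'
  change φ = pull (L : E7 →L[ℝ] E7) modelForm at hL
  change φ' = pull (L' : E7 →L[ℝ] E7) modelForm at hL'
  subst hL hL'
  obtain ⟨c, hc, hv⟩ := hor
  rw [vol_pull, vol_pull] at hv
  rw [dual_pull, dual_pull] at h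
  -- Comparing the two coframes, L' ∘ L⁻¹ preserves the model ψ and scales the volume form by c > 0,
  -- so it preserves the model φ.
  have key : ∀ {k : ℕ} {α β : Cov k}, pull (L' : E7 →L[ℝ] E7) α = pull (L : E7 →L[ℝ] E7) β →
      pull ((L.symm.trans L' : E7 ≃L[ℝ] E7) : E7 →L[ℝ] E7) α = β := by
    intro k α β hαβ
    rw [pull_trans, hαβ, pull_symm_pull]
  have := pull_modelForm_eq (L.symm.trans L') hc (key h) (key hv)
  rw [pull_trans] at this
  exact pull_injective L.symm (this.trans (pull_symm_pull L modelForm).symm)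

/-- The evaluation of forms on a tuple of vectors. -/
def evalₗ (v : Fin k → E7) : Cov k →ₗ[ℝ] ℝ where
  toFun β := β v
  map_add' _ _ := rfl
  map_smul' _ _ := rfl

/-- The value of the Hodge star on a tuple of vectors, as a linear map. -/
def starEvalₗ (φ : Cov 3) (h : k + l = 7) (v : Fin l → E7) : Cov k →ₗ[ℝ] ℝ :=
  evalₗ v ∘ₗ starₗ φ h

theorem starEvalₗ_apply (φ : Cov 3) (h : k + l = 7) (v : Fin l → E7) (β : Cov k) :
    starEvalₗ φ h v β = star φ h β v := rfl

/-- The form `ι_X φ ∧ ι_Y φ ∧ γ`. -/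
def contractWedgeForm (φ γ : Cov 3) (X Y : E7) : Cov 7 :=
  wedge (k := 4) (l := 3) rfl (wedge (k := 2) (l := 2) rfl (contract X φ) (contract Y φ)) γ

theorem contractWedge_eq (φ γ : Cov 3) (X Y : E7) :
    contractWedge φ γ X Y = contractWedgeForm φ γ X Y := contractWedge_apply φ γ X Y

theorem jMap_eq (φ γ : Cov 3) (X Y : E7) (h : 7 + 0 = 7) :
    jMap φ γ X Y = starEvalₗ φ h ![] (contractWedgeForm φ γ X Y) := by
  rw [starEvalₗ_apply]
  delta jMap
  refine DFunLike.congr_fun (?_ : (_ : Cov 0) = _) ![]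
  delta contractWedgeForm
  exact congrArg (star φ _) rfl

/-- For the trace only the linearity of ⋆ on 7-forms matters, so it is hidden behind an unspecified
functional. -/
theorem exists_jMap_eq (φ : Cov 3) : ∃ f : Cov 7 →ₗ[ℝ] ℝ, ∀ γ X Y,
    jMap φ γ X Y = f (contractWedge φ γ X Y) :=
  ⟨starEvalₗ φ (k := 7) (l := 0) rfl ![], fun γ X Y =>
    (jMap_eq φ γ X Y _).trans (congrArg _ (contractWedge_eq φ γ X Y).symm)⟩

theorem trace_jMap {φ γ : Cov 3} (hφ : IsG2 φ) (hγ : Mem27 φ γ) : trace φ (jMap φ γ) = 0 := by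
  obtain ⟨f, hf⟩ := exists_jMap_eq φ
  obtain ⟨L, hL⟩ := hφ
  change φ = pull (L : E7 →L[ℝ] E7) modelForm at hL
  have h1 : trace φ (jMap φ γ) =
      ∑ a, f (contractWedge φ γ (L.symm (stdVec a)) (L.symm (stdVec a))) := by
    have h2 : jMap φ γ = fun X Y => (contractWedge φ γ).compr₂ f X Y :=
      funext fun X => funext fun Y => hf γ X Y
    rw [h2]
    conv_lhs => rw [hL]
    rw [trace_pull L, ← hL]
    rfl
  have h2 : ∑ a, wedge (k := 2) (l := 2) (m := 4) rfl (contract (L.symm (stdVec a)) φ)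
      (contract (L.symm (stdVec a)) φ) = (6 : ℝ) • dual φ := by
    rw [hL, dual_pull]
    have h3 := congrArg (pull (L : E7 →L[ℝ] E7)) sum_contract_modelForm
    rw [pull_sum, pull_smul] at h3
    rw [← h3]
    refine Finset.sum_congr rfl fun a _ => ?_
    rw [pull_contract, ← pull_wedge, L.apply_symm_apply]
  have h4 : ∑ a, contractWedge φ γ (L.symm (stdVec a)) (L.symm (stdVec a)) = 0 := by
    simp only [contractWedge_apply]
    have h5 := congrArg (fun α => wedgeₗ (k := 4) (l := 3) (m := 7) rfl α γ) h2
    simp only [map_sum, LinearMap.sum_apply, wedgeₗ_apply] at h5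
    have hcomm : 3 + 4 = 7 := rfl
    have h7 : wedge hcomm γ (dual φ) = 0 := hγ.2
    rw [h5, wedge_smul_left, wedge_comm _ hcomm, h7, smul_zero, smul_zero]
  rw [h1, ← map_sum, h4, map_zero]

theorem invGram_symm {φ : Cov 3} (hφ : IsG2 φ) (i j : Fin 7) :
    invGram φ i j = invGram φ j i := by
  obtain ⟨L, hL⟩ := hφ
  change φ = pull (L : E7 →L[ℝ] E7) modelForm at hL
  rw [hL, invGram_pull]
  simp [Matrix.mul_apply, mul_comm]

/-- A skew form is paired with the symmetric matrix g^{ij}. -/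
theorem trace_cov {φ : Cov 3} (hφ : IsG2 φ) (α : Cov 2) : trace φ (fun X Y => α ![X, Y]) = 0 := by
  have hα : ∀ X Y, α ![Y, X] = -α ![X, Y] := by
    intro X Y
    have := cov_perm α ![X, Y] (Equiv.swap 0 1)
    rw [show ![Y, X] = fun a => ![X, Y] (Equiv.swap 0 1 a) from by
      funext a; fin_cases a <;> rfl, this]
    simp
  have h : trace φ (fun X Y => α ![X, Y]) = -trace φ (fun X Y => α ![X, Y]) := by
    conv_lhs => rw [trace, Finset.sum_comm]
    rw [trace, ← Finset.sum_neg_distrib]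
    refine Finset.sum_congr rfl fun i _ => ?_
    rw [← Finset.sum_neg_distrib]
    refine Finset.sum_congr rfl fun j _ => ?_
    rw [invGram_symm hφ, hα]
    ring
  linarith

theorem trace_metric {φ : Cov 3} (hφ : IsG2 φ) : trace φ (fun X Y => metric φ X Y) = 7 := by
  obtain ⟨L, hL⟩ := hφ
  change φ = pull (L : E7 →L[ℝ] E7) modelForm at hL
  rw [hL, trace_pull]
  simp only [metric_pull, ContinuousLinearEquiv.apply_symm_apply, inner_stdVec]
  simp

theorem trace_fullTorsion {φ : Cov 3} (hφ : IsG2 φ) (τ₀ : ℝ) (τ₁ : Cov 1) (τ₂ : Cov 2)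
    {τ₃ : Cov 3} (hτ₃ : Mem27 φ τ₃) : trace φ (fullTorsion φ τ₀ τ₁ τ₂ τ₃) = 7 / 4 * τ₀ := by
  have h : trace φ (fullTorsion φ τ₀ τ₁ τ₂ τ₃) =
      1 / 4 * τ₀ * trace φ (fun X Y => metric φ X Y)
        - trace φ (fun X Y => contract (sharp φ τ₁) φ ![X, Y])
        - 1 / 3 * trace φ (jMap φ τ₃) + 1 / 2 * trace φ (fun X Y => τ₂ ![X, Y]) := by
    simp only [trace, Finset.mul_sum, ← Finset.sum_sub_distrib, ← Finset.sum_add_distrib]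
    refine Finset.sum_congr rfl fun i _ => Finset.sum_congr rfl fun j _ => ?_
    rw [fullTorsion]
    ring
  rw [h, trace_metric hφ, trace_cov hφ, trace_cov hφ, trace_jMap hφ hτ₃]
  ring

end G2
end

noncomputable section

namespace G2

/-! ### The exterior derivative of a product -/

/-- Matches the wedge product with the sum in `alternatizeUncurryFin`, from which the exterior
derivative is built. -/
theorem wedge_one_apply {l : ℕ} (h : 1 + l = l + 1) (α : Cov 1) (β : Cov l)
    (v : Fin (l + 1) → E7) :
    wedge h α β v = ∑ i : Fin (l + 1), (-1 : ℝ) ^ (i : ℕ) *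
      (α (fun _ => v i) * β (i.removeNth v)) := by
  induction l with
  | zero =>
    rw [wedge_zero_right, Fin.sum_univ_one, ContinuousAlternatingMap.smul_apply, smul_eq_mul,
      mul_comm, Fin.val_zero, pow_zero, one_mul]
    congr 2
    · funext i
      rw [Subsingleton.elim (α := Fin 1) i 0]
    · exact Subsingleton.elim _ _
  | succ l ih =>
    have e : wedge h α β v = ((wedge h α β).curryLeft (v 0)) (Fin.tail v) := by
      rw [ContinuousAlternatingMap.curryLeft_apply_apply]
      congr 1
      exact (Fin.cons_self_tail v).symm
    have hc : (fun _ : Fin 1 => v 0) = Matrix.vecCons (v 0) ![] := by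
      funext i
      rw [Subsingleton.elim i 0]
      rfl
    rw [e, curryLeft_wedge (k := 0) (h := h) (h₁ := by omega) (h₂ := by omega),
      Fin.sum_univ_succ, ContinuousAlternatingMap.add_apply, ContinuousAlternatingMap.smul_apply,
      wedge_zero_left, ContinuousAlternatingMap.smul_apply, ih, smul_eq_mul, smul_eq_mul,
      Finset.mul_sum, ContinuousAlternatingMap.curryLeft_apply_apply, Fin.val_zero, pow_zero,
      one_mul, hc]
    refine congrArg₂ (· + ·) rfl (Finset.sum_congr rfl fun i _ => ?_)
    rw [ContinuousAlternatingMap.curryLeft_apply_apply, Fin.val_succ, pow_succ (-1 : ℝ) (i : ℕ),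
      zero_add, pow_one]
    have hr : Matrix.vecCons (v 0) (i.removeNth (Fin.tail v)) = i.succ.removeNth v := by
      funext j
      refine Fin.cases ?_ (fun j => ?_) j
      · simp [Fin.removeNth]
      · simp [Fin.removeNth, Fin.tail]
    rw [hr]
    change -1 * ((-1) ^ (i : ℕ) * (α (fun _ => v i.succ) * β (i.succ.removeNth v))) = _
    ring

/-- `df ∧ β` as an alternatization. -/
theorem alternatizeUncurryFin_smulRight {l : ℕ} (h : 1 + l = l + 1) (f : E7 →L[ℝ] ℝ) (β : Cov l) :
    ContinuousAlternatingMap.alternatizeUncurryFin (f.smulRight β) =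
      wedge h (ContinuousAlternatingMap.ofSubsingleton ℝ E7 ℝ 0 f) β := by
  ext v
  rw [wedge_one_apply, ContinuousAlternatingMap.alternatizeUncurryFin_apply]
  refine Finset.sum_congr rfl fun i _ => ?_
  simp

theorem extDeriv_mul {l : ℕ} (h : 1 + l = l + 1) {g : E7 → ℝ} {g' : E7 →L[ℝ] ℝ}
    {η : E7 → Cov l} {y : E7} (hg : HasFDerivAt g g' y) (hη : DifferentiableAt ℝ η y) :
    extDeriv (fun z => g z • η z) y =
      wedge h (ContinuousAlternatingMap.ofSubsingleton ℝ E7 ℝ 0 g') (η y) + g y • extDeriv η y := by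
  have e : fderiv ℝ (fun z => g z • η z) y = _ := (hg.smul hη.hasFDerivAt).fderiv
  rw [extDeriv, e, ContinuousAlternatingMap.alternatizeUncurryFin_add,
    ContinuousAlternatingMap.alternatizeUncurryFin_smul, alternatizeUncurryFin_smulRight h]
  exact add_comm _ _

/-! ### The exterior derivative on a manifold, read in the chart at the point -/

section Manifold

variable {M : Type*} [TopologicalSpace M] [ChartedSpace E7 M]

/-- Tangent vectors at x are expressed in the preferred chart at x, so the derivative of that chart
at x is the identity. -/
theorem d_apply [IsManifold (𝓡 7) ∞ M] {k : ℕ} (η : Form M k) (x : M) :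
    d η x = extDeriv (localForm η x) (extChartAt (𝓡 7) x x) := by
  have : IsManifold (𝓡 7) 1 M := .of_le (n := ∞) (by simp)
  unfold d
  rw [mfderiv_extChartAt_self]
  ext v
  rfl

theorem localForm_self [IsManifold (𝓡 7) ∞ M] {k : ℕ} (η : Form M k) (x : M) :
    localForm η x (extChartAt (𝓡 7) x x) = η x := by
  have : IsManifold (𝓡 7) 1 M := .of_le (n := ∞) (by simp)
  have e := mfderivWithin_range_extChartAt_symm (I := 𝓡 7) (x := x)
  rw [ModelWithCorners.range_eq_univ, mfderivWithin_univ] at e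
  unfold localForm
  rw [e, extChartAt_to_inv]
  ext v
  rfl

theorem IsSmooth.differentiableAt {k : ℕ} {η : Form M k} (hη : IsSmooth η) (x : M) :
    DifferentiableAt ℝ (localForm η x) (extChartAt (𝓡 7) x x) :=
  ((hη x).contDiffAt (extChartAt_target_mem_nhds x)).differentiableAt (by simp)

theorem localForm_add {k : ℕ} (η η' : Form M k) (x : M) :
    localForm (η + η') x = localForm η x + localForm η' x := rfl

theorem localForm_smul {k : ℕ} (f : M → ℝ) (η : Form M k) (x : M) :
    localForm (fun y => f y • η y) x =
      fun y => f ((extChartAt (𝓡 7) x).symm y) • localForm η x y := rfl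

theorem exists_hasFDerivAt {f : M → ℝ} (hf : ContMDiff (𝓡 7) 𝓘(ℝ, ℝ) ∞ f) (x : M) :
    ∃ f' : E7 →L[ℝ] ℝ, dFun f x = ContinuousAlternatingMap.ofSubsingleton ℝ E7 ℝ 0 f' ∧
      HasFDerivAt (fun y => f ((extChartAt (𝓡 7) x).symm y)) f' (extChartAt (𝓡 7) x x) := by
  have h := ((hf x).mdifferentiableAt (by simp)).hasMFDerivAt.2
  rw [ModelWithCorners.range_eq_univ] at h
  exact ⟨mfderiv (𝓡 7) 𝓘(ℝ, ℝ) f x, rfl,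
    hasFDerivWithinAt_univ.1 (show HasFDerivWithinAt (E := E7) (F := ℝ) _ _ Set.univ _ from h)⟩

theorem d_smul [IsManifold (𝓡 7) ∞ M] {f : M → ℝ} (hf : ContMDiff (𝓡 7) 𝓘(ℝ, ℝ) ∞ f) {k : ℕ}
    {h : 1 + k = k + 1} {η : Form M k} (hη : IsSmooth η) (x : M) :
    d (fun y => f y • η y) x = wedge h (dFun f x) (η x) + f x • d η x := by
  obtain ⟨f', e, hf'⟩ := exists_hasFDerivAt hf x
  rw [d_apply, d_apply, localForm_smul, extDeriv_mul h hf' (hη.differentiableAt x),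
    localForm_self, extChartAt_to_inv, e]

theorem d_add [IsManifold (𝓡 7) ∞ M] {k : ℕ} {η η' : Form M k} (x : M)
    (hη : DifferentiableAt ℝ (localForm η x) (extChartAt (𝓡 7) x x))
    (hη' : DifferentiableAt ℝ (localForm η' x) (extChartAt (𝓡 7) x x)) :
    d (η + η') x = d η x + d η' x := by
  rw [d_apply, d_apply, d_apply, localForm_add, extDeriv_add hη hη']

theorem differentiableAt_localForm_smul {f : M → ℝ} (hf : ContMDiff (𝓡 7) 𝓘(ℝ, ℝ) ∞ f) {k : ℕ}
    {η : Form M k} (hη : IsSmooth η) (x : M) :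
    DifferentiableAt ℝ (localForm (fun y => f y • η y) x) (extChartAt (𝓡 7) x x) :=
  (exists_hasFDerivAt hf x).choose_spec.2.differentiableAt.smul (hη.differentiableAt x)

theorem d_zero [IsManifold (𝓡 7) ∞ M] {k : ℕ} : d (0 : Form M k) = 0 := by
  funext x
  rw [d_apply]
  -- Homogeneity under the scalar 0 gives the vanishing.
  have : localForm (0 : Form M k) x = (0 : ℝ) • localForm (0 : Form M k) x := by
    rw [zero_smul]; rfl
  rw [this, extDeriv_smul, zero_smul]
  rfl

end Manifold

end G2

end

noncomputable section

namespace G2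

/-! ### The Laplacian of the dual form of a coclosed form -/

section Manifold

variable {M : Type*} [TopologicalSpace M] [ChartedSpace E7 M]
  {φ : Form M 3} {τ₀ : M → ℝ} {τ₁ : Form M 1} {τ₂ : Form M 2} {τ₃ : Form M 3}

theorem d_eq_of_coclosed (hφ : IsG2Form φ) (hτ : IsTorsion φ τ₀ τ₁ τ₂ τ₃) (hc : IsCoclosed φ)
    (x : M) : d φ x = τ₀ x • dual (φ x) + star (φ x) (k := 3) (l := 4) rfl (τ₃ x) := by
  have h := hτ.d_dual x
  rw [show d (dualF φ) x = 0 from congrFun hc x] at h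
  have h₁ : τ₁ x = 0 := eq_zero_of_wedge_dual (hφ.isG2 x) (sub_eq_zero.1 h.symm) (hτ.mem14 x)
  have h₂ := hτ.d_form x
  rw [h₁, ← wedgeₗ_apply, map_zero, LinearMap.zero_apply, smul_zero, add_zero] at h₂
  exact h₂

theorem codiff_dualF (hφ : IsG2Form φ) (hτ : IsTorsion φ τ₀ τ₁ τ₂ τ₃) (hc : IsCoclosed φ)
    {h : (3 + 1) + 3 = 7} :
    codiff φ (k := 3) (l := 3) h (dualF φ) = (fun x => τ₀ x • φ x) + τ₃ := by
  have e : starF φ (k := 3 + 1) (l := 3) h (dualF φ) = φ := by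
    funext x
    exact star_star (hφ.isG2 x) rfl h (φ x)
  funext x
  unfold codiff
  rw [e]
  have e₁ : ∀ p : 4 + 3 = 7, star (φ x) p (d φ x) = τ₀ x • φ x + τ₃ x := by
    intro p
    rw [d_eq_of_coclosed hφ hτ hc x, ← starₗ_apply, map_add, map_smul, starₗ_apply, starₗ_apply,
      star_star (hφ.isG2 x) rfl p (τ₃ x)]
    exact congrArg (fun z => τ₀ x • z + τ₃ x) (star_star (hφ.isG2 x) rfl p (φ x))
  -- The sign of d* on 4-forms.
  have e₂ : ((-1 : ℝ) ^ (3 + 1)) = 1 := by norm_num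
  rw [e₂, one_smul]
  exact e₁ _

theorem d_smul_of_coclosed [IsManifold (𝓡 7) ∞ M] (hφ : IsG2Form φ)
    (hτ : IsTorsion φ τ₀ τ₁ τ₂ τ₃) (hc : IsCoclosed φ)
    {f : M → ℝ} (hf : ContMDiff (𝓡 7) 𝓘(ℝ, ℝ) ∞ f) (x : M) :
    d (fun y => f y • φ y) x = wedge (k := 1) (l := 3) (m := 4) rfl (dFun f x) (φ x) +
      f x • (τ₀ x • dual (φ x) + star (φ x) (k := 3) (l := 4) rfl (τ₃ x)) := by
  rw [← d_eq_of_coclosed hφ hτ hc x]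
  exact d_smul (k := 3) (h := rfl) hf hφ.smooth x

theorem laplacianDual_eq [IsManifold (𝓡 7) ∞ M] (hφ : IsG2Form φ)
    (hτ : IsTorsion φ τ₀ τ₁ τ₂ τ₃) (hc : IsCoclosed φ)
    (x : M) :
    laplacianDual φ x = wedge (k := 1) (l := 3) (m := 4) rfl (dFun τ₀ x) (φ x) +
      τ₀ x • (τ₀ x • dual (φ x) + star (φ x) (k := 3) (l := 4) rfl (τ₃ x)) + d τ₃ x := by
  have e : ∀ p : (4 + 1) + 2 = 7, codiff φ (k := 4) (l := 2) p (d (dualF φ)) = 0 := by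
    intro p
    have h₀ : ∀ {k l : ℕ} (q : k + l = 7), starF φ q (0 : Form M k) = 0 := by
      intro k l q
      funext y
      exact map_zero (starₗ (φ y) q)
    rw [show d (dualF φ) = 0 from hc]
    unfold codiff
    rw [h₀, d_zero, h₀, smul_zero]
  have e₁ : laplacianDual φ = d ((fun x => τ₀ x • φ x) + τ₃) := by
    rw [← codiff_dualF hφ hτ hc (h := rfl)]
    unfold laplacianDual laplacian
    rw [e, add_zero]
  rw [e₁, d_add x (differentiableAt_localForm_smul hτ.smooth₀ hφ.smooth x)
    (hτ.smooth₃.differentiableAt x), d_smul_of_coclosed hφ hτ hc hτ.smooth₀ x]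

theorem neg_laplacianDual_eq [IsManifold (𝓡 7) ∞ M] (hφ : IsG2Form φ)
    (hτ : IsTorsion φ τ₀ τ₁ τ₂ τ₃)
    (hc : IsCoclosed φ) : -laplacianDual φ = rhsC φ τ₀ τ₃ := by
  funext x
  rw [Pi.neg_apply, laplacianDual_eq hφ hτ hc x]
  unfold rhsC
  -- What remains is linear in four forms, which may be treated as unknowns.
  generalize wedge (k := 1) (l := 3) (m := 4) rfl (dFun τ₀ x) (φ x) = a
  generalize dual (φ x) = b
  generalize star (φ x) (k := 3) (l := 4) rfl (τ₃ x) = c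
  generalize d τ₃ x = e
  module

theorem traceTorsion_eq (hφ : IsG2Form φ) (hτ : IsTorsion φ τ₀ τ₁ τ₂ τ₃) (x : M) :
    traceTorsion φ τ₀ τ₁ τ₂ τ₃ x = 7 / 4 * τ₀ x :=
  trace_fullTorsion (hφ.isG2 x) _ _ _ (hτ.mem27 x)

theorem dFun_sub_mul {f : M → ℝ} (hf : ContMDiff (𝓡 7) 𝓘(ℝ, ℝ) ∞ f) (A c : ℝ) (x : M) :
    dFun (fun y => A - c * f y) x = (-c) • dFun f x := by
  obtain ⟨f', e, hf'⟩ := exists_hasFDerivAt hf x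
  obtain ⟨g', e', hg'⟩ := exists_hasFDerivAt
    (f := fun y => A - c * f y) (contMDiff_const.sub (contMDiff_const.mul hf)) x
  rw [e, e', hg'.unique ((hf'.const_mul c).const_sub A), ← neg_smul]
  ext v
  rfl

/-- The factor of dφ = τ₀ψ + ⋆τ₃ is τ₀ + 2(A - 7/4 τ₀) = 2A - 5/2 τ₀. That of dτ₀ ∧ φ is 1 - 7/2 =
-5/2, and the sign is absorbed by φ ∧ dτ₀ = -dτ₀ ∧ φ. -/
theorem modified_laplacianDual_eq [IsManifold (𝓡 7) ∞ M] (A : ℝ) (hφ : IsG2Form φ)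
    (hτ : IsTorsion φ τ₀ τ₁ τ₂ τ₃) (hc : IsCoclosed φ) :
    (laplacianDual φ + (2 : ℝ) • d fun x => (A - traceTorsion φ τ₀ τ₁ τ₂ τ₃ x) • φ x) =
      rhsG A φ τ₀ τ₃ := by
  have hf : ContMDiff (𝓡 7) 𝓘(ℝ, ℝ) ∞ (fun y => A - 7 / 4 * τ₀ y) :=
    contMDiff_const.sub (contMDiff_const.mul hτ.smooth₀)
  funext x
  simp only [traceTorsion_eq hφ hτ]
  rw [Pi.add_apply, Pi.smul_apply, laplacianDual_eq hφ hτ hc x,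
    d_smul_of_coclosed hφ hτ hc hf x, dFun_sub_mul hτ.smooth₀, wedge_smul_left]
  unfold rhsG
  rw [wedge_comm (k := 3) (l := 1) (m := 4) rfl rfl]
  generalize wedge (k := 1) (l := 3) (m := 4) rfl (dFun τ₀ x) (φ x) = a
  generalize dual (φ x) = b
  generalize star (φ x) (k := 3) (l := 4) rfl (τ₃ x) = c
  generalize d τ₃ x = e
  norm_num
  module

end Manifold

/-! ### Comparison of initial data and of evolution equations -/

theorem dualF_eq_iff {M : Type*} [TopologicalSpace M] [ChartedSpace E7 M] {φ φ' : Form M 3}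
    (hφ : IsG2Form φ) (hφ' : IsG2Form φ') (hor : ∀ x, SameOrientation (φ x) (φ' x)) :
    dualF φ' = dualF φ ↔ φ' = φ :=
  ⟨fun h => funext fun x => eq_of_dual_eq (hφ.isG2 x) (hφ'.isG2 x) (hor x) (congrFun h x),
    fun h => h ▸ rfl⟩

theorem Evolves.congr {M : Type*} {k : ℕ} {I : Set ℝ} {η R R' : ℝ → Form M k}
    (h : Evolves I η R) (hR : ∀ t ∈ I, R t = R' t) : Evolves I η R' :=
  fun t ht x => hR t ht ▸ h t ht x

end G2

end

theorem proposition3p2 {M : Type*} [TopologicalSpace M] [ChartedSpace G2.E7 M]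
    [IsManifold (𝓡 7) ∞ M]
    (φ₀ : G2.Form M 3) (hφ₀ : G2.IsG2Form φ₀) (hcoclosed : G2.IsCoclosed φ₀)
    (A : ℝ) (hA : 0 < A)
    (I : Set ℝ) (hI : I.OrdConnected) (hI' : I.Nontrivial) (h0 : (0 : ℝ) ∈ I)
    (φ : ℝ → G2.Form M 3) (hφ : ∀ t ∈ I, G2.IsG2Form (φ t))
    (hor : ∀ x, G2.SameOrientation (φ₀ x) (φ 0 x))
    (τ₀ : ℝ → M → ℝ) (τ₁ : ℝ → G2.Form M 1) (τ₂ : ℝ → G2.Form M 2) (τ₃ : ℝ → G2.Form M 3)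
    (hτ : ∀ t ∈ I, G2.IsTorsion (φ t) (τ₀ t) (τ₁ t) (τ₂ t) (τ₃ t)) :
    (∀ t ∈ I, G2.IsCoclosed (φ t) →
      (∀ x, G2.traceTorsion (φ t) (τ₀ t) (τ₁ t) (τ₂ t) (τ₃ t) x = 7 / 4 * τ₀ t x) ∧
      -G2.laplacianDual (φ t) = G2.rhsC (φ t) (τ₀ t) (τ₃ t) ∧
      (G2.laplacianDual (φ t) + (2 : ℝ) • G2.d fun x =>
          (A - G2.traceTorsion (φ t) (τ₀ t) (τ₁ t) (τ₂ t) (τ₃ t) x) • φ t x) =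
        G2.rhsG A (φ t) (τ₀ t) (τ₃ t)) ∧
    (G2.IsLaplacianCoflow I φ₀ φ ↔
      G2.Evolves I (fun t => G2.dualF (φ t)) (fun t => G2.rhsC (φ t) (τ₀ t) (τ₃ t)) ∧
        (∀ t ∈ I, G2.d (G2.dualF (φ t)) = 0) ∧ φ 0 = φ₀) ∧
    (G2.IsModifiedCoflow I A φ₀ φ τ₀ τ₁ τ₂ τ₃ ↔
      G2.Evolves I (fun t => G2.dualF (φ t)) (fun t => G2.rhsG A (φ t) (τ₀ t) (τ₃ t)) ∧
        (∀ t ∈ I, G2.d (G2.dualF (φ t)) = 0) ∧ φ 0 = φ₀) := by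
  -- Closedness of ψ(t) belongs to every one of the systems, so the right-hand sides may be
  -- exchanged in both directions.
  have hC := fun t (ht : t ∈ I) (hc : G2.d (G2.dualF (φ t)) = 0) =>
    G2.neg_laplacianDual_eq (hφ t ht) (hτ t ht) hc
  have hG := fun t (ht : t ∈ I) (hc : G2.d (G2.dualF (φ t)) = 0) =>
    G2.modified_laplacianDual_eq A (hφ t ht) (hτ t ht) hc
  have hinit := G2.dualF_eq_iff hφ₀ (hφ 0 h0) hor
  refine ⟨fun t ht hc => ⟨G2.traceTorsion_eq (hφ t ht) (hτ t ht), hC t ht hc, hG t ht hc⟩,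
    ⟨fun h => ⟨?_, h.closed, hinit.1 h.initial⟩, fun h => ⟨?_, h.2.1, hinit.2 h.2.2⟩⟩,
    ⟨fun h => ⟨?_, h.closed, hinit.1 h.initial⟩, fun h => ⟨?_, h.2.1, hinit.2 h.2.2⟩⟩⟩
  · exact h.evolution.congr fun t ht => hC t ht (h.closed t ht)
  · exact h.1.congr fun t ht => (hC t ht (h.2.1 t ht)).symm
  · exact h.evolution.congr fun t ht => hG t ht (h.closed t ht)
  · exact h.1.congr fun t ht => (hG t ht (h.2.1 t ht)).symm
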